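/- Let $E$ be a locally compact Polish space with Borel $\sigma$-algebra $\mathscr E$, let $\mathscr B_b(E)$ be the bounded measurable real functions on $E$ and $C_0(E)$ the continuous real functions vanishing at infinity. For every $t\ge 0$ let $q_t$ be a stable conservative $q$-pair: for every $x\in E$, $q_t(x,\cdot)$ is a finite measure on $E$ with $q_t(x,\{x\})=0$, and for every $A\in\mathscr E$, $x\mapsto q_t(x,A)$ is measurable. Put $q_t(x):=q_t(x,E\setminus\{x\})$ and $$L_tf(x):=\int_E\big(f(y)-f(x)\big)\,q_t(x,dy).$$ Assume: $(A_1)$ For each $t\ge 0$ there is a unique homogeneous jump process with $q$-pair $q_t$, i.e. a unique family of transition probability kernels $\{P^{(t)}_s\}_{s\ge 0}$ on $E$ with $P^{(t)}_0(x,\cdot)=\delta_x$, $P^{(t)}_{s+r}=P^{(t)}_sP^{(t)}_r$ for $s,r\ge 0$, $\lim_{s\downarrow 0}P^{(t)}_s(x,\{x\})=1$ for $x\in E$, and, for all $f\in C_0(E)$, $s\ge 0$, pointwise on $E$, $$\partial_sP^{(t)}_sf=L_tP^{(t)}_sf=P^{(t)}_sL_tf,$$ where $P^{(t)}_sf(x):=\int_E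 f(y)P^{(t)}_s(x,dy)$, $L_tf$ is required to be $P^{(t)}_s(x,\cdot)$-integrable, and $\partial_s$ is one-sided at $s=0$. $(A_2)$ For all $T>0$ and $x\in E$, $$\lim_{\varepsilon\downarrow 0}\ \sup_{s,t\in[0,T],\,|t-s|\le\varepsilon}\|q_t(x,\cdot)-q_s(x,\cdot)\|_{var}=0,$$ where $\|\cdot\|_{var}$ is the total variation norm. $(A_3)$ There are a measurable function $V\ge 1$ on $E$, $K\in C([0,\infty);(0,\infty))$ and a constant $\theta>1$ such that for all $t\ge0$, $x\in E$, the function $V^\theta$ is $q_t(x,\cdot)$-integrable and $$q_t(x)\le K(t)V(x),\qquad L_tV^\theta(x)\le K(t)V^\theta(x).$$ Then there exists a unique inhomogeneous Markov jump process generated by $(L_t)_{t\ge0}$, that is, a unique family of transition probability kernels $\{P_{s,t}(x,\cdot):0\le s\le t<\infty,\ x\in E\}$ on $E$ with the following properties, where $P_{s,t}f(x):=\int_Ef(y)P_{s,t}(x,dy)$: 1. $P_{s,s}(x,\cdot)=\delta_x$ for $s\ge 0$, $x\in E$, and the jump condition holds: $\lim_{t\downarrow s}P_{s,t}(x,\{x\})=1$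 for $s\ge 0$ and $\lim_{s\uparrow t}P_{s,t}(x,\{x\})=1$ for $t>0$, $x\in E$; 2. $P_{s,t}=P_{s,r}P_{r,t}$ for $0\le s\le r\le t$; 3. for all $f\in\mathscr B_b(E)$ and $t>s\ge 0$, pointwise on $E$, $$\lim_{\varepsilon\downarrow 0}\frac{P_{s+\varepsilon,t}f-P_{s,t}f}{\varepsilon}=-L_sP_{s,t}f;$$ 4. for all $f\in\mathscr B_b(E)$, $t>s\ge 0$ and $x\in E$, the function $L_tf$ is $P_{s,t}(x,\cdot)$-integrable and $$\lim_{\varepsilon\downarrow 0}\frac{P_{s,t+\varepsilon}f(x)-P_{s,t}f(x)}{\varepsilon}=P_{s,t}L_tf(x).$$ -/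

import Mathlib

open MeasureTheory ProbabilityTheory Filter Topology Set
open scoped ENNReal ZeroAtInfty

noncomputable section

namespace JumpProcess

variable {E : Type*} [MeasurableSpace E]

/-- `f` belongs to the class of bounded measurable real functions on `E`. -/
def BoundedMeasurable (f : E → ℝ) : Prop :=
  Measurable f ∧ ∃ C : ℝ, ∀ x, |f x| ≤ C

/-- The total jump rate `q(x) = q(x, E \ {x})`. -/
def rate (q : Kernel E E) (x : E) : ℝ := (q x).real {x}ᶜ

/-- The operator `L f (x) = ∫ (f y - f x) q(x, dy)`. -/
def gen (q : Kernel E E) (f : E → ℝ) (x : E) : ℝ := ∫ y, (f y - f x) ∂(q x)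

/-- `P f (x) = ∫ f y P(x, dy)`. -/
def act (P : Kernel E E) (f : E → ℝ) (x : E) : ℝ := ∫ y, f y ∂(P x)

/-- The total variation distance `sup_{|f| ≤ 1} |μ(f) - ν(f)|` of two finite measures, the
supremum being over measurable functions. -/
def tvDist (μ ν : Measure E) : ℝ≥0∞ :=
  ⨆ (f : E → ℝ) (_ : Measurable f ∧ ∀ x, |f x| ≤ 1),
    ENNReal.ofReal |(∫ y, f y ∂μ) - ∫ y, f y ∂ν|

/-- For every time `t ≥ 0`, `q t` is a stable conservative q-pair: `q t x` is a finite measure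
without mass at `x` (measurability in `x` is part of `Kernel`). -/
structure IsStableConservative (q : ℝ → Kernel E E) : Prop where
  finite : ∀ t, 0 ≤ t → ∀ x, IsFiniteMeasure (q t x)
  no_self_jump : ∀ t, 0 ≤ t → ∀ x, q t x {x} = 0

/-- `(R s)_{s ≥ 0}` is (the family of transition probability kernels of) a homogeneous jump
process satisfying both Kolmogorov equations for the q-pair `q` on `C₀(E)`,
`∂ₛ Rₛ f = L Rₛ f = Rₛ L f` for `s ≥ 0`. At `s = 0` the derivative is one-sided. -/
structure IsHomogeneousJumpProcess [TopologicalSpace E] (q : Kernel E E) (R : ℝ → Kernel E E) :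
    Prop where
  markov : ∀ s, 0 ≤ s → IsMarkovKernel (R s)
  zero : R 0 = Kernel.id
  semigroup : ∀ s r, 0 ≤ s → 0 ≤ r → R (s + r) = R r ∘ₖ R s
  jump : ∀ x, Tendsto (fun s => R s x {x}) (𝓝[>] 0) (𝓝 1)
  backward : ∀ f : C₀(E, ℝ), ∀ s, 0 ≤ s → ∀ x,
    HasDerivWithinAt (fun u => act (R u) f x) (gen q (act (R s) f) x) (Ici 0) s
  forward : ∀ f : C₀(E, ℝ), ∀ s, 0 ≤ s → ∀ x, Integrable (gen q f) (R s x) ∧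
    HasDerivWithinAt (fun u => act (R u) f x) (act (R s) (gen q f) x) (Ici 0) s

/-- For each frozen time `t ≥ 0` there is a unique homogeneous jump process with q-pair `q t`. -/
def FrozenWellPosed [TopologicalSpace E] (q : ℝ → Kernel E E) : Prop :=
  ∀ t, 0 ≤ t → ∃ R : ℝ → Kernel E E, IsHomogeneousJumpProcess (q t) R ∧
    ∀ R' : ℝ → Kernel E E, IsHomogeneousJumpProcess (q t) R' → ∀ s, 0 ≤ s → R' s = R s

/-- Continuity of `t ↦ q t x` in total variation, uniformly on compact time intervals, for
each `x`. -/
def TimeContinuous (q : ℝ → Kernel E E) : Prop :=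
  ∀ T : ℝ, 0 < T → ∀ x, Tendsto
    (fun ε : ℝ => ⨆ (s ∈ Icc 0 T) (t ∈ Icc 0 T) (_ : |t - s| ≤ ε), tvDist (q t x) (q s x))
    (𝓝[>] 0) (𝓝 0)

/-- There are `V ≥ 1` measurable, `K ∈ C([0,∞); (0,∞))` and `θ > 1` with `q_t ≤ K(t) V` and
`L_t V^θ ≤ K(t) V^θ`. -/
def LyapunovCondition (q : ℝ → Kernel E E) : Prop :=
  ∃ (V : E → ℝ) (K : ℝ → ℝ) (θ : ℝ),
    Measurable V ∧ (∀ x, 1 ≤ V x) ∧ ContinuousOn K (Ici 0) ∧ (∀ t, 0 ≤ t → 0 < K t) ∧ 1 < θ ∧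
    ∀ t, 0 ≤ t → ∀ x, rate (q t) x ≤ K t * V x ∧
      Integrable (fun y => V y ^ θ) (q t x) ∧
      gen (q t) (fun y => V y ^ θ) x ≤ K t * V x ^ θ

/-- `(P s t)_{0 ≤ s ≤ t}` is (the family of transition probability kernels of) an inhomogeneous
Markov jump process generated by the operators `L_t` of `q t`. Values of `P` outside
`0 ≤ s ≤ t` play no role. The fields `jump_right` and `jump_left` say that the process is a
jump process: `P_{s,t}(x,{x}) → 1` as `t ↓ s` and as `s ↑ t`. -/
structure IsGeneratedBy (q : ℝ → Kernel E E) (P : ℝ → ℝ → Kernel E E) : Prop where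
  markov : ∀ s t, 0 ≤ s → s ≤ t → IsMarkovKernel (P s t)
  refl : ∀ s, 0 ≤ s → P s s = Kernel.id
  jump_right : ∀ s, 0 ≤ s → ∀ x, Tendsto (fun t => P s t x {x}) (𝓝[>] s) (𝓝 1)
  jump_left : ∀ t, 0 < t → ∀ x, Tendsto (fun s => P s t x {x}) (𝓝[<] t) (𝓝 1)
  semigroup : ∀ s r t, 0 ≤ s → s ≤ r → r ≤ t → P s t = P r t ∘ₖ P s r
  backward : ∀ f, BoundedMeasurable f → ∀ s t, 0 ≤ s → s < t → ∀ x,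
    Tendsto (fun ε : ℝ => (act (P (s + ε) t) f x - act (P s t) f x) / ε) (𝓝[>] 0)
      (𝓝 (-gen (q s) (act (P s t) f) x))
  forward : ∀ f, BoundedMeasurable f → ∀ s t, 0 ≤ s → s < t → ∀ x,
    Integrable (gen (q t) f) (P s t x) ∧
    Tendsto (fun ε : ℝ => (act (P s (t + ε)) f x - act (P s t) f x) / ε) (𝓝[>] 0)
      (𝓝 (act (P s t) (gen (q t) f) x))

end JumpProcess

end

/-!
Uniqueness is a maximum principle for the backward equation. On `[0, T]` the jump rates are bounded
by a function `c`, and a multiple `W ≥ c` of `V ^ θ` satisfies `L_t W ≤ C W`. A bounded solution `w`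
with `w t ≤ 0` satisfies `w s ≤ δ exp (C (t - s)) W` for every `δ > 0`: where `c` is large the right
side exceeds the bound of `w`, and where `c` is bounded the error in this estimate can be halved
again and again by comparison of right derivatives. Let `δ → 0`.

Existence is uniformization by the time-independent rate `c`: the process jumps from `x` at rate
`c x`, with a jump law that also allows jumps from `x` to `x`. Summing over the number of jumps
gives the minimal kernel, which solves the backward integral equation, and continuity of `t ↦ q t x`
in total variation turns this into the backward differential equation. The constant `1` solves the
same equation, so uniqueness makes the minimal kernel conservative, and uniqueness also yields the
Chapman–Kolmogorov equation. The forward equation is the derivative at `τ = t` of `P_{t,τ} f`,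
integrated against `P_{s,t} (x, ·)`, where `c` dominates the difference quotients and is integrable
because `W` is a Lyapunov function.
-/

noncomputable section

namespace JumpProcess

section RealAnalysis

theorem nonneg_left_of_deriv_right_nonpos {g g' : ℝ → ℝ} {a b : ℝ} (hab : a ≤ b)
    (hg : ContinuousOn g (Icc a b))
    (hg' : ∀ s ∈ Ico a b, HasDerivWithinAt g (g' s) (Ici s) s)
    (hneg : ∀ s ∈ Ico a b, g s < 0 → g' s ≤ 0) (hb : 0 ≤ g b) : 0 ≤ g a := by
  by_contra! ha
  set η : ℝ := -g a / (2 * (b - a + 1)) with hη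
  have hη0 : 0 < η := div_pos (by linarith) (by linarith)
  have hηb : η * (b - a + 1) = -g a / 2 := by
    rw [hη]; field_simp [show b - a + 1 ≠ 0 by linarith]
  have hline_neg : ∀ s ∈ Icc a b, g a + η * (s - a) < 0 := fun s hs => by
    have : η * (s - a) ≤ η * (b - a + 1) :=
      mul_le_mul_of_nonneg_left (by linarith [hs.2]) hη0.le
    linarith
  have hle_line : g b ≤ g a + η * (b - a) :=
    image_le_of_deriv_right_lt_deriv_boundary (B := fun s => g a + η * (s - a)) hg hg' (by simp)
      (fun s => by simpa using (((hasDerivAt_id s).sub_const a).const_mul η).const_add (g a))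
      (fun s hs h => (hneg s hs (h ▸ hline_neg s (Ico_subset_Icc_self hs))).trans_lt hη0)
      (right_mem_Icc.2 hab)
  linarith [hline_neg b (right_mem_Icc.2 hab)]

theorem hasDerivWithinAt_Ici_iff_tendsto_slope_zero {g : ℝ → ℝ} {g' s : ℝ} :
    HasDerivWithinAt g g' (Ici s) s ↔
      Tendsto (fun ε => (g (s + ε) - g s) / ε) (𝓝[>] 0) (𝓝 g') := by
  rw [hasDerivWithinAt_iff_tendsto_slope, Ici_sdiff_left]
  have hmap : map (fun ε => s + ε) (𝓝[>] (0 : ℝ)) = 𝓝[>] s := by simp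
  rw [← hmap, tendsto_map'_iff]
  refine tendsto_congr fun ε => ?_
  simp [slope_def_field]

/-- The variation of constants formula: the solution on `(-∞, t]` of the backward equation
`φ' = k φ - H` with terminal value `φ t = y`. -/
def duhamel (k y t : ℝ) (H : ℝ → ℝ) (s : ℝ) : ℝ :=
  Real.exp (-(k * (t - s))) * y + ∫ r in s..t, Real.exp (-(k * (r - s))) * H r

variable {k y t : ℝ} {H : ℝ → ℝ}

theorem duhamel_eq (s : ℝ) : duhamel k y t H s =
    Real.exp (k * s) * (Real.exp (-(k * t)) * y + ∫ r in s..t, Real.exp (-(k * r)) * H r) := by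
  have hexp : ∀ r, Real.exp (-(k * (r - s))) = Real.exp (k * s) * Real.exp (-(k * r)) := fun r => by
    rw [← Real.exp_add]; congr 1; ring
  simp only [duhamel, hexp, mul_assoc, intervalIntegral.integral_const_mul, mul_add]

theorem continuous_duhamel (hH : ∀ a b, IntervalIntegrable H volume a b) :
    Continuous (duhamel k y t H) := by
  have hint : ∀ a b, IntervalIntegrable (fun r => Real.exp (-(k * r)) * H r) volume a b :=
    fun a b => (hH a b).continuousOn_mul (by fun_prop)
  have hprim : Continuous fun s => ∫ r in s..t, Real.exp (-(k * r)) * H r := by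
    simp_rw [fun s => intervalIntegral.integral_symm (μ := volume)
      (f := fun r => Real.exp (-(k * r)) * H r) t s]
    exact (intervalIntegral.continuous_primitive hint t).neg
  rw [funext duhamel_eq]
  fun_prop

theorem hasDerivWithinAt_duhamel {s : ℝ} (hm : StronglyMeasurable H)
    (hH : IntervalIntegrable H volume s t) (hs : ContinuousWithinAt H (Ici s) s) :
    HasDerivWithinAt (duhamel k y t H) (k * duhamel k y t H s - H s) (Ici s) s := by
  have hprim : HasDerivWithinAt (fun s => ∫ r in s..t, Real.exp (-(k * r)) * H r)
      (-(Real.exp (-(k * s)) * H s)) (Ici s) s :=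
    intervalIntegral.integral_hasDerivWithinAt_left (hH.continuousOn_mul (by fun_prop))
      ((show StronglyMeasurable fun r => Real.exp (-(k * r)) from
        (by fun_prop : Measurable _).stronglyMeasurable).mul hm |>.stronglyMeasurableAtFilter)
      ((by fun_prop : ContinuousWithinAt (fun r => Real.exp (-(k * r))) (Ici s) s).mul hs
        |>.mono Ioi_subset_Ici_self)
  have hexp : HasDerivWithinAt (fun s => Real.exp (k * s)) (Real.exp (k * s) * k) (Ici s) s := by
    simpa using (((hasDerivAt_id s).const_mul k).exp).hasDerivWithinAt (s := Ici s)
  have hcancel : Real.exp (k * s) * Real.exp (-(k * s)) = 1 := by rw [← Real.exp_add]; simp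
  rw [funext (duhamel_eq (k := k) (y := y) (t := t) (H := H))]
  refine (hexp.mul (hprim.const_add _)).congr_deriv ?_
  linear_combination (-H s) * hcancel

end RealAnalysis

section BoundedMeasurable

variable {E : Type*} [MeasurableSpace E] {f : E → ℝ}

theorem BoundedMeasurable.integrable (hf : BoundedMeasurable f) (μ : Measure E)
    [IsFiniteMeasure μ] : Integrable f μ :=
  let ⟨hfm, _, hB⟩ := hf
  .of_bound hfm.aestronglyMeasurable _ (ae_of_all _ hB)

theorem boundedMeasurable_const (a : ℝ) : BoundedMeasurable fun _ : E => a :=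
  ⟨measurable_const, |a|, fun _ => le_rfl⟩

theorem boundedMeasurable_indicator {A : Set E} (hA : MeasurableSet A) :
    BoundedMeasurable (A.indicator (1 : E → ℝ)) :=
  ⟨measurable_one.indicator hA, 1, fun y => by by_cases hy : y ∈ A <;> simp [hy]⟩

end BoundedMeasurable

section Act

variable {E : Type*} [MeasurableSpace E] {P R : Kernel E E} {f : E → ℝ} {B : ℝ}

theorem measurable_act (hf : Measurable f) : Measurable (act P f) :=
  (StronglyMeasurable.integral_kernel hf.stronglyMeasurable).measurable

theorem act_id (hf : Measurable f) : act Kernel.id f = f := by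
  ext x
  rw [act, Kernel.id_apply, integral_dirac' _ _ hf.stronglyMeasurable]

theorem act_comp [IsFiniteKernel P] [IsFiniteKernel R] (hf : BoundedMeasurable f) :
    act (R ∘ₖ P) f = act P (act R f) :=
  funext fun _ => Kernel.integral_comp (hf.integrable _)

theorem abs_act_le [IsMarkovKernel P] (hB : ∀ x, |f x| ≤ B) (x : E) : |act P f x| ≤ B := by
  simpa [act] using norm_integral_le_of_norm_le_const (μ := P x) (f := f) (ae_of_all _ hB)

theorem BoundedMeasurable.act [IsMarkovKernel P] (hf : BoundedMeasurable f) :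
    BoundedMeasurable (act P f) :=
  let ⟨hfm, B, hB⟩ := hf
  ⟨measurable_act hfm, B, abs_act_le hB⟩

theorem kernel_ext_of_act [IsFiniteKernel P] [IsFiniteKernel R]
    (h : ∀ f, BoundedMeasurable f → act P f = act R f) : P = R := by
  refine Kernel.ext fun x => Measure.ext fun A hA => ?_
  have hreal : (P x).real A = (R x).real A := by
    simpa only [JumpProcess.act, integral_indicator_one hA] using
      congrFun (h _ (boundedMeasurable_indicator hA)) x
  rw [← ofReal_measureReal, hreal, ofReal_measureReal]

theorem abs_act_sub_le [MeasurableSingletonClass E] [IsMarkovKernel P] (hf : Measurable f)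
    (hB : ∀ x, |f x| ≤ B) (x : E) : |act P f x - f x| ≤ 2 * B * (1 - (P x).real {x}) := by
  have hoff : act P f x - f x = ∫ y in {x}ᶜ, (f y - f x) ∂P x := by
    have hfi : Integrable f (P x) := BoundedMeasurable.integrable ⟨hf, B, hB⟩ _
    rw [setIntegral_eq_integral_of_forall_compl_eq_zero (by simp +contextual),
      integral_sub hfi (integrable_const _)]
    simp [act]
  rw [hoff, ← probReal_compl_eq_one_sub (measurableSet_singleton x)]
  refine norm_setIntegral_le_of_norm_le_const (f := fun y => f y - f x)
    (measure_lt_top (P x) _) fun y _ => ?_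
  rw [Real.norm_eq_abs]
  linarith [abs_sub (f y) (f x), hB y, hB x]

end Act

section Gen

variable {E : Type*} [MeasurableSpace E] {q : Kernel E E} {x : E} {f g W : E → ℝ} {B : ℝ}

theorem gen_eq [IsFiniteMeasure (q x)] (hf : Integrable f (q x)) :
    gen q f x = act q f x - (q x).real univ * f x := by
  rw [gen, act, integral_sub hf (integrable_const _)]; simp

theorem gen_sub [IsFiniteMeasure (q x)] (hf : Integrable f (q x)) (hg : Integrable g (q x)) :
    gen q (f - g) x = gen q f x - gen q g x := by
  rw [gen_eq hf, gen_eq hg, gen_eq (hf.sub hg), act, integral_sub' hf hg, act, act, Pi.sub_apply]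
  ring

theorem abs_gen_le [IsFiniteMeasure (q x)] (hB : ∀ y, |f y| ≤ B) :
    |gen q f x| ≤ 2 * B * (q x).real univ := by
  refine norm_integral_le_of_norm_le_const (μ := q x) (f := fun y => f y - f x)
    (ae_of_all _ fun y => ?_)
  rw [Real.norm_eq_abs]
  linarith [abs_sub (f y) (f x), hB y, hB x]

theorem measurable_gen (hq : ∀ x, IsFiniteMeasure (q x)) (hf : BoundedMeasurable f) :
    Measurable (gen q f) := by
  have hgen : gen q f = fun x => act q f x - (q x).real univ * f x :=
    funext fun x => gen_eq (hf.integrable _)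
  rw [hgen]
  exact (measurable_act hf.1).sub ((q.measurable_coe MeasurableSet.univ).ennreal_toReal.mul hf.1)

theorem gen_le_of_le [IsFiniteMeasure (q x)] (hf : Integrable f (q x)) (hW : Integrable W (q x))
    {a b : ℝ} (hle : ∀ y, f y ≤ a * W y + b) :
    gen q f x ≤ a * gen q W x + (q x).real univ * (a * W x + b - f x) := by
  have hint : act q f x ≤ a * act q W x + (q x).real univ * b := by
    calc act q f x ≤ ∫ y, (a * W y + b) ∂q x :=
          integral_mono hf ((hW.const_mul a).add (integrable_const b)) hle
      _ = a * act q W x + (q x).real univ * b := by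
          rw [integral_add (hW.const_mul a) (integrable_const b), integral_const_mul]
          simp [act]
  rw [gen_eq hf, gen_eq hW]
  linarith

end Gen

section TotalVariation

variable {E : Type*} [MeasurableSpace E] {q : ℝ → Kernel E E} {B T : ℝ}

theorem ofReal_abs_integral_sub_le_tvDist {μ ν : Measure E} {f : E → ℝ} (hf : Measurable f)
    (hB : ∀ y, |f y| ≤ B) :
    ENNReal.ofReal |(∫ y, f y ∂μ) - ∫ y, f y ∂ν| ≤ ENNReal.ofReal B * tvDist μ ν := by
  rcases le_or_gt B 0 with hB0 | hB0
  · have hf0 : f = 0 := funext fun y => abs_nonpos_iff.1 ((hB y).trans hB0)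
    simp [hf0]
  · have hscale : |(∫ y, f y ∂μ) - ∫ y, f y ∂ν| = B * |(∫ y, f y / B ∂μ) - ∫ y, f y / B ∂ν| := by
      rw [integral_div, integral_div, ← sub_div, abs_div, abs_of_pos hB0,
        mul_div_cancel₀ _ hB0.ne']
    have hunit : ∀ y, |f y / B| ≤ 1 := fun y => by
      rw [abs_div, abs_of_pos hB0, div_le_one hB0]; exact hB y
    rw [hscale, ENNReal.ofReal_mul hB0.le]
    gcongr
    exact le_iSup₂_of_le (fun y => f y / B) ⟨hf.div_const B, hunit⟩ le_rfl

/-- Continuity of `t ↦ q t x` on `[0, ∞)` in total variation, for every fixed `x`. -/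
def IsTVContinuous (q : ℝ → Kernel E E) : Prop :=
  ∀ s, 0 ≤ s → ∀ x, Tendsto (fun t => tvDist (q t x) (q s x)) (𝓝[Ici 0] s) (𝓝 0)

theorem TimeContinuous.isTVContinuous (hq : TimeContinuous q) : IsTVContinuous q := by
  intro s hs x
  refine ENNReal.tendsto_nhds_zero.2 fun δ hδ => ?_
  obtain ⟨η, hηδ, hη⟩ :=
    ((hq (s + 1) (by linarith) x).eventually_le_const hδ |>.and self_mem_nhdsWithin).exists
  have hnear : ∀ᶠ t in 𝓝[Ici 0] s, t < s + 1 ∧ |t - s| ≤ η :=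
    nhdsWithin_le_nhds <| (eventually_lt_nhds (by linarith)).and
      (Metric.closedBall_mem_nhds s hη)
  filter_upwards [self_mem_nhdsWithin, hnear] with t ht0 ⟨htT, hts⟩
  refine le_trans ?_ hηδ
  exact le_iSup₂_of_le s ⟨hs, by linarith⟩
    (le_iSup₂_of_le t ⟨ht0, htT.le⟩ (le_iSup_of_le hts le_rfl))

theorem IsTVContinuous.eventually_abs_integral_sub_le (h : IsTVContinuous q) {s : ℝ} (hs : 0 ≤ s)
    (x : E) (B : ℝ) {δ : ℝ} (hδ : 0 < δ) : ∀ᶠ r in 𝓝[Ici 0] s, ∀ f : E → ℝ, Measurable f →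
      (∀ y, |f y| ≤ B) → |(∫ y, f y ∂q r x) - ∫ y, f y ∂q s x| ≤ δ := by
  have hbound : Tendsto (fun r => ENNReal.ofReal B * tvDist (q r x) (q s x)) (𝓝[Ici 0] s)
      (𝓝 0) := by
    simpa using ENNReal.Tendsto.const_mul (h s hs x) (Or.inr ENNReal.ofReal_ne_top)
  filter_upwards [hbound.eventually_le_const (ENNReal.ofReal_pos.2 hδ)] with r hr f hf hB
  exact (ENNReal.ofReal_le_ofReal_iff hδ.le).1
    ((ofReal_abs_integral_sub_le_tvDist hf hB).trans hr)

theorem IsTVContinuous.continuousOn_integral (h : IsTVContinuous q)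
    (hq : ∀ s ∈ Icc 0 T, ∀ x, IsFiniteMeasure (q s x)) {u : ℝ → E → ℝ}
    (hu : ∀ s ∈ Icc 0 T, Measurable (u s)) (hB : ∀ s ∈ Icc 0 T, ∀ y, |u s y| ≤ B)
    (hcont : ∀ y, ContinuousOn (fun s => u s y) (Icc 0 T)) (x : E) :
    ContinuousOn (fun s => ∫ y, u s y ∂q s x) (Icc 0 T) := by
  intro s hs
  have := hq s hs x
  have hfrozen : Tendsto (fun r => ∫ y, u r y ∂q s x) (𝓝[Icc 0 T] s) (𝓝 (∫ y, u s y ∂q s x)) := by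
    refine tendsto_integral_filter_of_dominated_convergence (fun _ => B) ?_ ?_
      (integrable_const _) (ae_of_all _ fun y => hcont y s hs)
    · filter_upwards [self_mem_nhdsWithin] with r hr using (hu r hr).aestronglyMeasurable
    · filter_upwards [self_mem_nhdsWithin] with r hr using ae_of_all _ (hB r hr)
  have hchange : Tendsto (fun r => (∫ y, u r y ∂q r x) - ∫ y, u r y ∂q s x) (𝓝[Icc 0 T] s)
      (𝓝 0) := by
    refine Metric.tendsto_nhds.2 fun δ hδ => ?_
    filter_upwards [self_mem_nhdsWithin, nhdsWithin_mono s Icc_subset_Ici_self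
      (h.eventually_abs_integral_sub_le hs.1 x B (half_pos hδ))] with r hr hle
    rw [dist_zero_right]
    exact (hle _ (hu r hr) (hB r hr)).trans_lt (half_lt_self hδ)
  simpa [ContinuousWithinAt] using hchange.add hfrozen

theorem IsTVContinuous.continuousOn_gen (h : IsTVContinuous q)
    (hq : ∀ s ∈ Icc 0 T, ∀ x, IsFiniteMeasure (q s x)) {u : ℝ → E → ℝ}
    (hu : ∀ s ∈ Icc 0 T, Measurable (u s)) (hB : ∀ s ∈ Icc 0 T, ∀ y, |u s y| ≤ B)
    (hcont : ∀ y, ContinuousOn (fun s => u s y) (Icc 0 T)) (x : E) :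
    ContinuousOn (fun s => gen (q s) (u s) x) (Icc 0 T) :=
  h.continuousOn_integral hq (u := fun s y => u s y - u s x) (B := B + B)
    (fun s hs => (hu s hs).sub_const _)
    (fun s hs y => (abs_sub _ _).trans (add_le_add (hB s hs y) (hB s hs x)))
    (fun y => (hcont y).sub (hcont x)) x

end TotalVariation

section Lyapunov

variable {E : Type*} [MeasurableSpace E] {q : ℝ → Kernel E E} {c W : E → ℝ} {C T s t : ℝ}

/-- On `[0, T]` the jump rates are dominated by `c`, and `W ≥ c` is a Lyapunov function:
`L_t W ≤ C W`. The bound `c` does not depend on time, so that it can serve as a uniformization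
rate. -/
structure IsLyapunovOn (q : ℝ → Kernel E E) (c W : E → ℝ) (C T : ℝ) : Prop where
  measurable_c : Measurable c
  measurable_W : Measurable W
  c_pos : ∀ x, 0 < c x
  c_le_W : ∀ x, c x ≤ W x
  nonneg : 0 ≤ C
  finite : ∀ t ∈ Icc 0 T, ∀ x, IsFiniteMeasure (q t x)
  mass_le : ∀ t ∈ Icc 0 T, ∀ x, (q t x).real univ ≤ c x
  integrable_W : ∀ t ∈ Icc 0 T, ∀ x, Integrable W (q t x)
  gen_le : ∀ t ∈ Icc 0 T, ∀ x, gen (q t) W x ≤ C * W x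

/-- Existence of Lyapunov functions on all compact time intervals, which may depend on the
interval. -/
def HasLocalLyapunov (q : ℝ → Kernel E E) : Prop :=
  ∀ T, 0 ≤ T → ∃ c W C, IsLyapunovOn q c W C T

theorem IsLyapunovOn.W_pos (h : IsLyapunovOn q c W C T) (x : E) : 0 < W x :=
  (h.c_pos x).trans_le (h.c_le_W x)

theorem IsLyapunovOn.mono (h : IsLyapunovOn q c W C T) (ht : t ≤ T) : IsLyapunovOn q c W C t :=
  have hsub : Icc 0 t ⊆ Icc 0 T := Icc_subset_Icc_right ht
  { h with
    finite := fun s hs => h.finite s (hsub hs)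
    mass_le := fun s hs => h.mass_le s (hsub hs)
    integrable_W := fun s hs => h.integrable_W s (hsub hs)
    gen_le := fun s hs => h.gen_le s (hsub hs) }

theorem IsLyapunovOn.integrable_c (h : IsLyapunovOn q c W C T) (hs : s ∈ Icc 0 T) (x : E) :
    Integrable c (q s x) :=
  (h.integrable_W s hs x).mono' h.measurable_c.aestronglyMeasurable (ae_of_all _ fun y => by
    rw [Real.norm_eq_abs, abs_of_pos (h.c_pos y)]; exact h.c_le_W y)

theorem IsLyapunovOn.abs_gen_le (h : IsLyapunovOn q c W C T) (ht : t ∈ Icc 0 T) {f : E → ℝ} {B : ℝ}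
    (hB : ∀ y, |f y| ≤ B) (x : E) : |gen (q t) f x| ≤ 2 * B * c x := by
  have := h.finite t ht x
  have hB0 : 0 ≤ B := (abs_nonneg _).trans (hB x)
  exact (JumpProcess.abs_gen_le hB).trans
    (mul_le_mul_of_nonneg_left (h.mass_le t ht x) (by positivity))

theorem IsLyapunovOn.integrable_gen (h : IsLyapunovOn q c W C T) (ht : t ∈ Icc 0 T) {f : E → ℝ}
    (hf : BoundedMeasurable f) {μ : Measure E} (hμ : Integrable c μ) :
    Integrable (gen (q t) f) μ :=
  let ⟨B, hB⟩ := hf.2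
  (hμ.const_mul (2 * B)).mono' (measurable_gen (h.finite t ht) hf).aestronglyMeasurable
    (ae_of_all _ (h.abs_gen_le ht hB))

theorem IsStableConservative.rate_eq [MeasurableSingletonClass E] (hq : IsStableConservative q)
    (ht : 0 ≤ t) (x : E) : rate (q t) x = (q t x).real univ := by
  have := hq.finite t ht x
  rw [rate, measureReal_compl (measurableSet_singleton x), measureReal_def (q t x) {x},
    hq.no_self_jump t ht x]
  simp

theorem IsStableConservative.hasLocalLyapunov [MeasurableSingletonClass E]
    (hq : IsStableConservative q) (hL : LyapunovCondition q) : HasLocalLyapunov q := by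
  obtain ⟨V, K, θ, hV, hV1, hK, hKpos, hθ, hVq⟩ := hL
  intro T hT
  obtain ⟨a, ha, hmax⟩ := isCompact_Icc.exists_isMaxOn (nonempty_Icc.2 hT)
    (hK.mono Icc_subset_Ici_self)
  have hKa := hKpos a ha.1
  have hV0 : ∀ x, 0 < V x := fun x => one_pos.trans_le (hV1 x)
  refine ⟨fun x => K a * V x, fun x => K a * V x ^ θ, K a, hV.const_mul _,
    (hV.pow_const θ).const_mul _, fun x => mul_pos hKa (hV0 x), fun x => ?_, hKa.le,
    fun t ht => hq.finite t ht.1, fun t ht x => ?_,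
    fun t ht x => (hVq t ht.1 x).2.1.const_mul _, fun t ht x => ?_⟩
  · exact mul_le_mul_of_nonneg_left (Real.self_le_rpow_of_one_le (hV1 x) hθ.le) hKa.le
  · rw [← hq.rate_eq ht.1]
    exact (hVq t ht.1 x).1.trans (mul_le_mul_of_nonneg_right (hmax ht) (hV0 x).le)
  · have hgen : gen (q t) (fun y => K a * V y ^ θ) x = K a * gen (q t) (fun y => V y ^ θ) x := by
      simp only [gen, ← mul_sub, integral_const_mul]
    rw [hgen]
    refine mul_le_mul_of_nonneg_left ((hVq t ht.1 x).2.2.trans ?_) hKa.le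
    exact mul_le_mul_of_nonneg_right (hmax ht) (Real.rpow_nonneg (hV0 x).le _)

end Lyapunov

section BackwardEquation

variable {E : Type*} [MeasurableSpace E] {q : ℝ → Kernel E E} {c W : E → ℝ} {B C t : ℝ}
  {u v w : ℝ → E → ℝ}

/-- `u` is a bounded solution on `[0, t]` of the backward equation `∂ₛ uₛ = -Lₛ uₛ`, in the sense of
right derivatives. -/
structure IsBackwardSolution (q : ℝ → Kernel E E) (t : ℝ) (u : ℝ → E → ℝ) : Prop where
  measurable : ∀ s ∈ Icc 0 t, Measurable (u s)
  bounded : ∃ B, ∀ s ∈ Icc 0 t, ∀ x, |u s x| ≤ B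
  continuousOn : ∀ x, ContinuousOn (fun s => u s x) (Icc 0 t)
  hasDeriv : ∀ x, ∀ s ∈ Ico 0 t,
    HasDerivWithinAt (fun r => u r x) (-gen (q s) (u s) x) (Ici s) s

namespace IsBackwardSolution

theorem boundedMeasurable (hu : IsBackwardSolution q t u) {s : ℝ} (hs : s ∈ Icc 0 t) :
    BoundedMeasurable (u s) :=
  let ⟨B, hB⟩ := hu.bounded
  ⟨hu.measurable s hs, B, hB s hs⟩

theorem const (a : ℝ) : IsBackwardSolution q t (fun _ _ => a) :=
  ⟨fun _ _ => measurable_const, ⟨|a|, fun _ _ _ => le_rfl⟩, fun _ => continuousOn_const,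
    fun _ s _ => by simpa [gen] using hasDerivWithinAt_const s (Ici s) a⟩

theorem mono (hu : IsBackwardSolution q t u) {r : ℝ} (hrt : r ≤ t) : IsBackwardSolution q r u :=
  have hsub : Icc 0 r ⊆ Icc 0 t := Icc_subset_Icc_right hrt
  ⟨fun s hs => hu.measurable s (hsub hs), hu.bounded.imp fun _ hB s hs => hB s (hsub hs),
    fun x => (hu.continuousOn x).mono hsub,
    fun x s hs => hu.hasDeriv x s (Ico_subset_Ico_right hrt hs)⟩

theorem sub (hq : ∀ s ∈ Icc 0 t, ∀ x, IsFiniteMeasure (q s x))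
    (hu : IsBackwardSolution q t u) (hv : IsBackwardSolution q t v) :
    IsBackwardSolution q t (u - v) := by
  obtain ⟨A, hA⟩ := hu.bounded
  obtain ⟨B, hB⟩ := hv.bounded
  refine ⟨fun s hs => (hu.measurable s hs).sub (hv.measurable s hs),
    ⟨A + B, fun s hs x => (abs_sub _ _).trans (add_le_add (hA s hs x) (hB s hs x))⟩,
    fun x => (hu.continuousOn x).sub (hv.continuousOn x), fun x s hs => ?_⟩
  have hs' : s ∈ Icc 0 t := Ico_subset_Icc_self hs
  have := hq s hs' x
  rw [Pi.sub_apply, gen_sub ((hu.boundedMeasurable hs').integrable _)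
    ((hv.boundedMeasurable hs').integrable _)]
  exact ((hu.hasDeriv x s hs).sub (hv.hasDeriv x s hs)).congr_deriv (by ring)

theorem abs_sub_sub_mul_le (hu : IsBackwardSolution q t u) {s δ L : ℝ} (hs : s ∈ Icc 0 t) {x : E}
    (hL : ∀ r ∈ Ico s t, |gen (q r) (u r) x - L| ≤ δ) :
    |u s x - u t x - (t - s) * L| ≤ δ * (t - s) := by
  have hderiv : ∀ r ∈ Ico s t,
      HasDerivWithinAt (fun r => u r x + r * L) (-gen (q r) (u r) x + L) (Ici r) r := fun r hr =>
    ((hu.hasDeriv x r ⟨hs.1.trans hr.1, hr.2⟩).add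
      ((hasDerivAt_id r).mul_const L).hasDerivWithinAt).congr_deriv (by rw [one_mul])
  have hmean := norm_image_sub_le_of_norm_deriv_right_le_segment
    (((hu.continuousOn x).mono (Icc_subset_Icc_left hs.1)).add (by fun_prop)) hderiv
    (fun r hr => by rw [Real.norm_eq_abs, neg_add_eq_sub, abs_sub_comm]; exact hL r hr)
    t (right_mem_Icc.2 hs.2)
  rw [Real.norm_eq_abs, abs_sub_comm] at hmean
  convert hmean using 2
  simp only [Pi.add_apply]
  ring

theorem abs_sub_le (h : IsLyapunovOn q c W C t) (hu : IsBackwardSolution q t u)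
    (hB : ∀ s ∈ Icc 0 t, ∀ x, |u s x| ≤ B) {s : ℝ} (hs : s ∈ Icc 0 t) (x : E) :
    |u s x - u t x| ≤ 2 * B * c x * (t - s) := by
  have hgen : ∀ r ∈ Ico s t, |gen (q r) (u r) x - 0| ≤ 2 * B * c x := fun r hr => by
    have hr' : r ∈ Icc 0 t := ⟨hs.1.trans hr.1, hr.2.le⟩
    simpa using h.abs_gen_le hr' (hB r hr') x
  simpa using hu.abs_sub_sub_mul_le hs hgen

/-- A bound of the form `δ * exp (C * (t - s)) * W x` up to an error `M * exp (l * (t - s))`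
improves itself: where `l ≤ c x` the first term alone dominates `B`, and elsewhere the total jump
rate is at most `l`. -/
theorem le_add_half_mul_exp_of_le (h : IsLyapunovOn q c W C t) (hw : IsBackwardSolution q t w)
    (h0 : ∀ x, w t x ≤ 0) (hB : ∀ s ∈ Icc 0 t, ∀ x, w s x ≤ B) {δ l M : ℝ} (hδ : 0 ≤ δ)
    (hl : B ≤ δ * l) (hM : 0 ≤ M)
    (hle : ∀ s ∈ Icc 0 t, ∀ x,
      w s x ≤ δ * Real.exp (C * (t - s)) * W x + M * Real.exp (l * (t - s)))
    {s : ℝ} (hs : s ∈ Icc 0 t) (x : E) :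
    w s x ≤ δ * Real.exp (C * (t - s)) * W x + M / 2 * Real.exp (l * (t - s)) := by
  have hW := h.W_pos
  rcases le_or_gt l (c x) with hlc | hcl
  · have hexp : 1 ≤ Real.exp (C * (t - s)) :=
      Real.one_le_exp (mul_nonneg h.nonneg (sub_nonneg.2 hs.2))
    calc w s x ≤ δ * l := (hB s hs x).trans hl
      _ ≤ δ * 1 * W x := by rw [mul_one]; gcongr; exact hlc.trans (h.c_le_W x)
      _ ≤ δ * Real.exp (C * (t - s)) * W x := by have := hW x; gcongr
      _ ≤ _ := le_add_of_nonneg_right (by positivity)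
  · set g : ℝ → ℝ := fun r =>
      δ * Real.exp (C * (t - r)) * W x + M / 2 * Real.exp (l * (t - r)) - w r x with hg
    suffices hgs : 0 ≤ g s from sub_nonneg.1 hgs
    have hexp : ∀ k r : ℝ,
        HasDerivAt (fun r => Real.exp (k * (t - r))) (Real.exp (k * (t - r)) * -k) r :=
      fun k r => by simpa using (((hasDerivAt_id r).const_sub t).const_mul k).exp
    have hderiv : ∀ r ∈ Ico s t, HasDerivWithinAt g (δ * (Real.exp (C * (t - r)) * -C) * W x
        + M / 2 * (Real.exp (l * (t - r)) * -l) - -gen (q r) (w r) x) (Ici r) r := fun r hr =>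
      ((((hexp C r).const_mul δ).mul_const (W x)).add
        ((hexp l r).const_mul (M / 2))).hasDerivWithinAt.sub
          (hw.hasDeriv x r ⟨hs.1.trans hr.1, hr.2⟩)
    refine nonneg_left_of_deriv_right_nonpos hs.2 (.sub (by fun_prop)
      ((hw.continuousOn x).mono (Icc_subset_Icc_left hs.1))) hderiv (fun r hr hneg => ?_) ?_
    · have hr' : r ∈ Icc 0 t := ⟨hs.1.trans hr.1, hr.2.le⟩
      have := h.finite r hr' x
      have hgen := gen_le_of_le ((hw.boundedMeasurable hr').integrable (q r x))
        (h.integrable_W r hr' x) (hle r hr')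
      have hLyap := mul_le_mul_of_nonneg_left (h.gen_le r hr' x)
        (mul_nonneg hδ (Real.exp_pos (C * (t - r))).le)
      have hmass := mul_le_mul_of_nonneg_right ((h.mass_le r hr' x).trans hcl.le)
        (mul_nonneg (div_nonneg hM two_pos.le) (Real.exp_pos (l * (t - r))).le)
      have hjump := mul_nonneg (measureReal_nonneg (μ := q r x) (s := univ)) (neg_pos.2 hneg).le
      simp only [hg] at hjump
      linarith
    · have hWx := hW x
      have := h0 x
      simp only [hg, sub_self, mul_zero, Real.exp_zero, mul_one]
      nlinarith [mul_nonneg hδ hWx.le]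

theorem le_mul_exp (h : IsLyapunovOn q c W C t) (hw : IsBackwardSolution q t w)
    (h0 : ∀ x, w t x ≤ 0) {δ : ℝ} (hδ : 0 < δ) {s : ℝ} (hs : s ∈ Icc 0 t) (x : E) :
    w s x ≤ δ * Real.exp (C * (t - s)) * W x := by
  obtain ⟨B, hB⟩ := hw.bounded
  have hB0 : 0 ≤ B := (abs_nonneg _).trans (hB s hs x)
  have hwB : ∀ s ∈ Icc 0 t, ∀ x, w s x ≤ B := fun s hs x => (le_abs_self _).trans (hB s hs x)
  have hhalf : ∀ n : ℕ, ∀ s ∈ Icc 0 t, ∀ x, w s x ≤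
      δ * Real.exp (C * (t - s)) * W x + B / 2 ^ n * Real.exp (B / δ * (t - s)) := by
    intro n
    induction n with
    | zero =>
      intro s hs x
      have := h.W_pos x
      have hexp : 1 ≤ Real.exp (B / δ * (t - s)) :=
        Real.one_le_exp (mul_nonneg (by positivity) (sub_nonneg.2 hs.2))
      calc w s x ≤ B / 2 ^ 0 * 1 := by simpa using hwB s hs x
        _ ≤ B / 2 ^ 0 * Real.exp (B / δ * (t - s)) := by gcongr
        _ ≤ _ := le_add_of_nonneg_left (by positivity)
    | succ n ih =>
      intro s hs x
      have := hw.le_add_half_mul_exp_of_le h h0 hwB hδ.le (mul_div_cancel₀ B hδ.ne').ge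
        (by positivity) ih hs x
      rwa [div_div, ← pow_succ] at this
  have hlim : Tendsto (fun n : ℕ => δ * Real.exp (C * (t - s)) * W x
      + B / 2 ^ n * Real.exp (B / δ * (t - s))) atTop
      (𝓝 (δ * Real.exp (C * (t - s)) * W x + 0 * Real.exp (B / δ * (t - s)))) :=
    ((tendsto_const_nhds.div_atTop (tendsto_pow_atTop_atTop_of_one_lt one_lt_two)).mul_const
      _).const_add _
  simpa using ge_of_tendsto' hlim fun n => hhalf n s hs x

theorem nonpos (h : IsLyapunovOn q c W C t) (hw : IsBackwardSolution q t w)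
    (h0 : ∀ x, w t x ≤ 0) {s : ℝ} (hs : s ∈ Icc 0 t) (x : E) : w s x ≤ 0 := by
  have hlim : Tendsto (fun δ : ℝ => δ * Real.exp (C * (t - s)) * W x) (𝓝[>] 0) (𝓝 0) :=
    tendsto_nhdsWithin_of_tendsto_nhds (Continuous.tendsto' (by fun_prop) _ _ (by simp))
  exact ge_of_tendsto hlim (eventually_mem_nhdsWithin.mono fun δ hδ => hw.le_mul_exp h h0 hδ hs x)

theorem unique (h : IsLyapunovOn q c W C t) (hu : IsBackwardSolution q t u)
    (hv : IsBackwardSolution q t v) (h0 : u t = v t) {s : ℝ} (hs : s ∈ Icc 0 t) : u s = v s := by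
  ext x
  refine le_antisymm (sub_nonpos.1 ?_) (sub_nonpos.1 ?_)
  · exact (hu.sub h.finite hv).nonpos h (by simp [h0]) hs x
  · exact (hv.sub h.finite hu).nonpos h (by simp [h0]) hs x

end IsBackwardSolution

end BackwardEquation

section BackwardEvolution

variable {E : Type*} [MeasurableSpace E] {q : ℝ → Kernel E E} {c W : E → ℝ} {B C r s t : ℝ}
  {P R : ℝ → Kernel E E} {f : E → ℝ}

/-- `P s` is a transition kernel from time `s ∈ [0, t]` to the fixed time `t`, such that
`s ↦ P s f` solves the backward equation for all bounded measurable `f`. -/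
structure IsBackwardEvolution (q : ℝ → Kernel E E) (t : ℝ) (P : ℝ → Kernel E E) : Prop where
  markov : ∀ s ∈ Icc 0 t, IsMarkovKernel (P s)
  terminal : P t = Kernel.id
  isBackwardSolution : ∀ f, BoundedMeasurable f → IsBackwardSolution q t fun s => act (P s) f

namespace IsBackwardEvolution

theorem unique (h : IsLyapunovOn q c W C t) (hP : IsBackwardEvolution q t P)
    (hR : IsBackwardEvolution q t R) (hs : s ∈ Icc 0 t) : P s = R s := by
  have := hP.markov s hs
  have := hR.markov s hs
  exact kernel_ext_of_act fun f hf => (hP.isBackwardSolution f hf).unique h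
    (hR.isBackwardSolution f hf) (congrArg (act · f) (hP.terminal.trans hR.terminal.symm)) hs

theorem eq_comp (h : IsLyapunovOn q c W C r) (hP : IsBackwardEvolution q t P)
    (hR : IsBackwardEvolution q r R) (hs : s ∈ Icc 0 r) (hrt : r ≤ t) : P s = P r ∘ₖ R s := by
  have := hP.markov s ⟨hs.1, hs.2.trans hrt⟩
  have := hP.markov r ⟨hs.1.trans hs.2, hrt⟩
  have := hR.markov s hs
  refine kernel_ext_of_act fun f hf => ?_
  rw [act_comp hf]
  refine ((hP.isBackwardSolution f hf).mono hrt).unique h (hR.isBackwardSolution _ hf.act) ?_ hs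
  rw [hR.terminal, act_id (measurable_act hf.1)]

theorem abs_act_sub_le (h : IsLyapunovOn q c W C t) (hP : IsBackwardEvolution q t P)
    (hf : Measurable f) (hB : ∀ y, |f y| ≤ B) (hs : s ∈ Icc 0 t) (x : E) :
    |act (P s) f x - f x| ≤ 2 * B * c x * (t - s) := by
  have hbdd : ∀ r ∈ Icc 0 t, ∀ y, |act (P r) f y| ≤ B := fun r hr =>
    have := hP.markov r hr
    abs_act_le hB
  simpa [hP.terminal, act_id hf] using (hP.isBackwardSolution f ⟨hf, B, hB⟩).abs_sub_le h hbdd hs x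

theorem le_measure_singleton [MeasurableSingletonClass E] (h : IsLyapunovOn q c W C t)
    (hP : IsBackwardEvolution q t P) (hs : s ∈ Icc 0 t) (x : E) :
    ENNReal.ofReal (1 - 2 * c x * (t - s)) ≤ P s x {x} := by
  have := hP.markov s hs
  have hx : MeasurableSet {x} := measurableSet_singleton x
  have hact := hP.abs_act_sub_le h (f := ({x} : Set E).indicator 1) (B := 1)
    (measurable_one.indicator hx) (fun y => by by_cases hy : y ∈ ({x} : Set E) <;> simp [hy]) hs x
  rw [act, integral_indicator_one hx, indicator_of_mem (mem_singleton x), Pi.one_apply,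
    mul_one] at hact
  rw [← ofReal_measureReal]
  exact ENNReal.ofReal_le_ofReal (by linarith [neg_abs_le ((P s x).real {x} - 1)])

theorem abs_gen_act_sub_gen_le (h : IsLyapunovOn q c W C t) (hP : IsBackwardEvolution q t P)
    (hf : Measurable f) (hB : ∀ y, |f y| ≤ B) (hs : s ∈ Icc 0 t) (hr : r ∈ Icc 0 t) (x : E) :
    |gen (q s) (act (P r) f) x - gen (q s) f x|
      ≤ (t - r) * ∫ y, 2 * B * (c y + c x) ∂q s x := by
  have := h.finite s hs x
  have := hP.markov r hr
  have hfb : BoundedMeasurable f := ⟨hf, B, hB⟩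
  have hdom : Integrable (fun y => 2 * B * (c y + c x)) (q s x) :=
    ((h.integrable_c hs x).add (integrable_const _)).const_mul _
  rw [← gen_sub (hfb.act.integrable _) (hfb.integrable _), ← integral_const_mul]
  refine norm_integral_le_of_norm_le (μ := q s x)
    (f := fun y => (act (P r) f - f) y - (act (P r) f - f) x) (hdom.const_mul _)
    (ae_of_all _ fun y => ?_)
  have hy := hP.abs_act_sub_le h hf hB hr y
  have hx := hP.abs_act_sub_le h hf hB hr x
  rw [Real.norm_eq_abs, Pi.sub_apply, Pi.sub_apply]
  linarith [abs_sub (act (P r) f y - f y) (act (P r) f x - f x)]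

end IsBackwardEvolution

end BackwardEvolution

section MinimalKernel

variable {E : Type*} [MeasurableSpace E]

/-- Density in `r` of the first jump time before `t` of a process which starts at time `p.1` in
the state `p.2` and jumps at the exponential rate `c p.2`. -/
def jumpTimeDensity (c : E → ℝ) (t : ℝ) (p : ℝ × E) (r : ℝ) : ℝ :=
  (Ioc p.1 t).indicator (fun r => c p.2 * Real.exp (-(c p.2 * (r - p.1)))) r

/-- Law of the first jump time before `t`, a subprobability measure. -/
def jumpTimeKernel (c : E → ℝ) (t : ℝ) : Kernel (ℝ × E) ℝ :=
  (Kernel.const (ℝ × E) (volume : Measure ℝ)).withDensity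
    fun p r => ENNReal.ofReal (jumpTimeDensity c t p r)

instance (c : E → ℝ) (t : ℝ) : IsSFiniteKernel (jumpTimeKernel c t) :=
  Kernel.IsSFiniteKernel.withDensity _ fun _ _ => ENNReal.ofReal_ne_top

/-- Joint law of time and target of the first jump before `t`, where a jump from `x` at time `r`
has the law `Q (r, x)`. -/
def jumpKernel (Q : Kernel (ℝ × E) E) (c : E → ℝ) (t : ℝ) : Kernel (ℝ × E) (ℝ × E) :=
  jumpTimeKernel c t ⊗ₖ
    Q.comap (fun a : (ℝ × E) × ℝ => (a.2, a.1.2)) (by fun_prop)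

/-- The part without jumps of the law at time `t`. Starting times after `t` are treated like `t`,
which keeps the mass at most one. -/
def stayKernel (c : E → ℝ) (t : ℝ) : Kernel (ℝ × E) E :=
  (Kernel.deterministic (Prod.snd : ℝ × E → E) measurable_snd).withDensity
    fun p _ => ENNReal.ofReal (Real.exp (-(c p.2 * max (t - p.1) 0)))

/-- The part with exactly `n` jumps of the law at time `t`. -/
def jumpCountKernel (Q : Kernel (ℝ × E) E) (c : E → ℝ) (t : ℝ) : ℕ → Kernel (ℝ × E) E
  | 0 => stayKernel c t
  | n + 1 => jumpCountKernel Q c t n ∘ₖ jumpKernel Q c t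

/-- The law at time `t` of the minimal jump process with jump rate `c` and jump law `Q`, as a
function of the starting time and the starting point: at time `t` there have been only finitely
many jumps. -/
def minimalKernel (Q : Kernel (ℝ × E) E) (c : E → ℝ) (t : ℝ) : Kernel (ℝ × E) E :=
  Kernel.sum (jumpCountKernel Q c t)

variable {Q : Kernel (ℝ × E) E} {c : E → ℝ} {t : ℝ}

theorem minimalKernel_eq_add_comp :
    minimalKernel Q c t = stayKernel c t + minimalKernel Q c t ∘ₖ jumpKernel Q c t := by
  have hcomp : minimalKernel Q c t ∘ₖ jumpKernel Q c t
      = Kernel.sum fun n => jumpCountKernel Q c t (n + 1) := by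
    simp only [minimalKernel, Kernel.comp_sum_left, jumpCountKernel]
  refine Kernel.ext fun p => Measure.ext fun A hA => ?_
  rw [hcomp, _root_.add_apply, Measure.add_apply, minimalKernel,
    Kernel.sum_apply' _ _ hA, Kernel.sum_apply' _ _ hA]
  exact tsum_eq_zero_add' (f := fun n => jumpCountKernel Q c t n p A) ENNReal.summable

theorem measurable_jumpTimeDensity (hc : Measurable c) :
    Measurable (Function.uncurry (jumpTimeDensity c t)) := by
  have hind : Function.uncurry (jumpTimeDensity c t)
      = {a : (ℝ × E) × ℝ | a.1.1 < a.2 ∧ a.2 ≤ t}.indicator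
        fun a => c a.1.2 * Real.exp (-(c a.1.2 * (a.2 - a.1.1))) := by
    ext a; simp [jumpTimeDensity, Function.uncurry, indicator]
  rw [hind]
  refine Measurable.indicator (by fun_prop) ?_
  exact (measurableSet_lt measurable_fst.fst measurable_snd).inter
    (measurableSet_le measurable_snd measurable_const)

theorem measurable_stayDensity (hc : Measurable c) : Measurable (Function.uncurry
    fun (p : ℝ × E) (_ : E) => ENNReal.ofReal (Real.exp (-(c p.2 * max (t - p.1) 0)))) := by
  simp only [Function.uncurry_def]
  fun_prop

theorem lintegral_stayKernel (hc : Measurable c) (p : ℝ × E) {φ : E → ℝ≥0∞} (hφ : Measurable φ) :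
    ∫⁻ y, φ y ∂stayKernel c t p
      = ENNReal.ofReal (Real.exp (-(c p.2 * max (t - p.1) 0))) * φ p.2 := by
  rw [stayKernel, Kernel.lintegral_withDensity _ (measurable_stayDensity hc) _ hφ,
    Kernel.deterministic_apply, lintegral_dirac' _ (by fun_prop)]

theorem integral_stayKernel (hc : Measurable c) {f : E → ℝ} (hf : Measurable f) {s : ℝ}
    (hs : s ≤ t) (x : E) :
    ∫ y, f y ∂stayKernel c t (s, x) = Real.exp (-(c x * (t - s))) * f x := by
  rw [stayKernel, Kernel.withDensity_apply _ (measurable_stayDensity hc),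
    integral_withDensity_eq_integral_toReal_smul (by fun_prop)
      (ae_of_all _ fun _ => ENNReal.ofReal_lt_top), Kernel.deterministic_apply,
    integral_dirac' _ _ (by fun_prop)]
  simp [max_eq_left (sub_nonneg.2 hs), Real.exp_nonneg]

theorem lintegral_jumpKernel [IsSFiniteKernel Q] (hc : Measurable c) (p : ℝ × E)
    {ψ : ℝ × E → ℝ≥0∞} (hψ : Measurable ψ) :
    ∫⁻ a, ψ a ∂jumpKernel Q c t p = ∫⁻ r in Ioc p.1 t,
      ENNReal.ofReal (c p.2 * Real.exp (-(c p.2 * (r - p.1)))) * ∫⁻ y, ψ (r, y) ∂Q (r, p.2) := by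
  rw [jumpKernel, Kernel.lintegral_compProd _ _ _ hψ, jumpTimeKernel, Kernel.lintegral_withDensity _
    (measurable_jumpTimeDensity hc).ennreal_ofReal, Kernel.const_apply,
    ← lintegral_indicator measurableSet_Ioc]
  · refine lintegral_congr fun r => ?_
    by_cases hr : r ∈ Ioc p.1 t <;> simp [jumpTimeDensity, hr, Kernel.comap_apply]
  · exact Measurable.lintegral_kernel_prod_right'' (a := p)
      (η := Q.comap (fun a : (ℝ × E) × ℝ => (a.2, a.1.2)) (by fun_prop)) hψ

theorem integral_jumpKernel [IsSFiniteKernel Q] (hc : Measurable c) (hc0 : ∀ x, 0 ≤ c x) {s : ℝ}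
    (hs : s ≤ t) (x : E) {ψ : ℝ × E → ℝ} (hψ : Integrable ψ (jumpKernel Q c t (s, x))) :
    ∫ a, ψ a ∂jumpKernel Q c t (s, x) = ∫ r in s..t,
      Real.exp (-(c x * (r - s))) * (c x * ∫ y, ψ (r, y) ∂Q (r, x)) := by
  have hd := (measurable_jumpTimeDensity (t := t) hc).ennreal_ofReal
  have hdx : Measurable fun r => ENNReal.ofReal (jumpTimeDensity c t (s, x) r) :=
    hd.comp measurable_prodMk_left
  have hd0 : ∀ r, 0 ≤ jumpTimeDensity c t (s, x) r :=
    indicator_nonneg fun _ _ => mul_nonneg (hc0 _) (Real.exp_pos _).le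
  rw [jumpKernel, ProbabilityTheory.integral_compProd hψ, jumpTimeKernel,
    Kernel.withDensity_apply _ hd, integral_withDensity_eq_integral_toReal_smul
      hdx (ae_of_all _ fun _ => ENNReal.ofReal_lt_top),
    Kernel.const_apply, intervalIntegral.integral_of_le hs, ← integral_indicator measurableSet_Ioc]
  refine integral_congr_ae (ae_of_all _ fun r => ?_)
  beta_reduce
  rw [ENNReal.toReal_ofReal (hd0 r)]
  by_cases hr : r ∈ Ioc s t
  · simp only [jumpTimeDensity, hr, indicator_of_mem, Kernel.comap_apply, smul_eq_mul]
    ring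
  · simp [jumpTimeDensity, hr]

theorem integral_exp_mul_exp (k C s t : ℝ) :
    ∫ r in s..t, (C + k) * Real.exp (-(k * (r - s))) * Real.exp (C * (t - r))
      = Real.exp (C * (t - s)) - Real.exp (-(k * (t - s))) := by
  have hder : ∀ r : ℝ, HasDerivAt (fun r => -(Real.exp (-(k * (r - s))) * Real.exp (C * (t - r))))
      ((C + k) * Real.exp (-(k * (r - s))) * Real.exp (C * (t - r))) r := fun r => by
    have hstay : HasDerivAt (fun r => -(k * (r - s))) (-(k * 1)) r :=
      (((hasDerivAt_id r).sub_const s).const_mul k).neg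
    have hgrow : HasDerivAt (fun r => C * (t - r)) (C * (-1)) r :=
      ((hasDerivAt_id r).const_sub t).const_mul C
    exact (hstay.exp.mul hgrow.exp).neg.congr_deriv (by ring)
  rw [intervalIntegral.integral_eq_sub_of_hasDerivAt (fun r _ => hder r)
    (Continuous.intervalIntegrable (by fun_prop) _ _)]
  simp only [sub_self, mul_zero, neg_zero, Real.exp_zero, mul_one, one_mul]
  ring

theorem ofReal_exp_add_lintegral_exp_mul_exp {k C : ℝ} (hk : 0 ≤ k) (hC : 0 ≤ C) (s t : ℝ) :
    ENNReal.ofReal (Real.exp (-(k * max (t - s) 0))) + ∫⁻ r in Ioc s t,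
        ENNReal.ofReal ((C + k) * Real.exp (-(k * (r - s))) * Real.exp (C * (t - r)))
      = ENNReal.ofReal (Real.exp (C * max (t - s) 0)) := by
  rcases le_total t s with hts | hst
  · simp [Ioc_eq_empty_of_le hts, max_eq_right (sub_nonpos.2 hts)]
  · have hnonneg : ∀ r, 0 ≤ (C + k) * Real.exp (-(k * (r - s))) * Real.exp (C * (t - r)) :=
      fun r => by positivity
    rw [← ofReal_integral_eq_lintegral_ofReal (Continuous.integrableOn_Ioc (by fun_prop))
      (ae_of_all _ hnonneg), ← ENNReal.ofReal_add (Real.exp_nonneg _) (integral_nonneg hnonneg),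
      ← intervalIntegral.integral_of_le hst, integral_exp_mul_exp, max_eq_left (sub_nonneg.2 hst),
      add_sub_cancel]

theorem lintegral_stayKernel_add_lintegral_jumpKernel_le [IsSFiniteKernel Q] (hc : Measurable c)
    (hc0 : ∀ x, 0 ≤ c x) {C : ℝ} (hC : 0 ≤ C) {φ : E → ℝ≥0∞} (hφ : Measurable φ)
    {ψ : ℝ × E → ℝ≥0∞} (hψ : Measurable ψ) {s : ℝ} {x : E}
    (hQ : ∀ r ∈ Ioc s t,
      ENNReal.ofReal (c x) * ∫⁻ y, φ y ∂Q (r, x) ≤ ENNReal.ofReal (C + c x) * φ x)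
    (hle : ∀ r ∈ Ioc s t, ∀ y, ψ (r, y) ≤ ENNReal.ofReal (Real.exp (C * max (t - r) 0)) * φ y) :
    ∫⁻ y, φ y ∂stayKernel c t (s, x) + ∫⁻ a, ψ a ∂jumpKernel Q c t (s, x)
      ≤ ENNReal.ofReal (Real.exp (C * max (t - s) 0)) * φ x := by
  have hcx := hc0 x
  have hjump : ∀ r ∈ Ioc s t,
      ENNReal.ofReal (c x * Real.exp (-(c x * (r - s)))) * ∫⁻ y, ψ (r, y) ∂Q (r, x)
        ≤ ENNReal.ofReal ((C + c x) * Real.exp (-(c x * (r - s))) * Real.exp (C * (t - r)))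
          * φ x := fun r hr => by
    have hψφ : ∫⁻ y, ψ (r, y) ∂Q (r, x)
        ≤ ENNReal.ofReal (Real.exp (C * (t - r))) * ∫⁻ y, φ y ∂Q (r, x) := by
      rw [← lintegral_const_mul _ hφ, ← max_eq_left (sub_nonneg.2 hr.2)]
      exact lintegral_mono (hle r hr)
    rw [ENNReal.ofReal_mul hcx, ENNReal.ofReal_mul (by positivity),
      ENNReal.ofReal_mul (by positivity)]
    calc _ ≤ _ := mul_le_mul_right hψφ _
      _ = ENNReal.ofReal (Real.exp (-(c x * (r - s)))) * ENNReal.ofReal (Real.exp (C * (t - r)))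
          * (ENNReal.ofReal (c x) * ∫⁻ y, φ y ∂Q (r, x)) := by ring
      _ ≤ _ := mul_le_mul_right (hQ r hr) _
      _ = _ := by ring
  rw [lintegral_stayKernel hc _ hφ, lintegral_jumpKernel hc _ hψ,
    ← ofReal_exp_add_lintegral_exp_mul_exp hcx hC s t, add_mul,
    ← lintegral_mul_const _ (by fun_prop)]
  exact add_le_add_right (setLIntegral_mono' measurableSet_Ioc hjump) _

theorem sum_lintegral_jumpCountKernel_succ (p : ℝ × E) {φ : E → ℝ≥0∞} (hφ : Measurable φ) (n : ℕ) :
    ∑ i ∈ Finset.range (n + 1), ∫⁻ y, φ y ∂jumpCountKernel Q c t i p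
      = ∫⁻ y, φ y ∂stayKernel c t p
        + ∫⁻ a, ∑ i ∈ Finset.range n, ∫⁻ y, φ y ∂jumpCountKernel Q c t i a ∂jumpKernel Q c t p := by
  rw [Finset.sum_range_succ', lintegral_finsetSum _ fun i _ => hφ.lintegral_kernel, add_comm]
  simp only [jumpCountKernel, Kernel.lintegral_comp _ _ _ hφ]

theorem lintegral_minimalKernel_le [IsSFiniteKernel Q] (hc : Measurable c) (hc0 : ∀ x, 0 ≤ c x)
    {C : ℝ} (hC : 0 ≤ C) {φ : E → ℝ≥0∞} (hφ : Measurable φ) {s₀ : ℝ}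
    (hQ : ∀ r ∈ Icc s₀ t, ∀ x,
      ENNReal.ofReal (c x) * ∫⁻ y, φ y ∂Q (r, x) ≤ ENNReal.ofReal (C + c x) * φ x)
    {s : ℝ} (hs : s₀ ≤ s) (x : E) :
    ∫⁻ y, φ y ∂minimalKernel Q c t (s, x)
      ≤ ENNReal.ofReal (Real.exp (C * max (t - s) 0)) * φ x := by
  have hpartial : ∀ n s, s₀ ≤ s → ∀ x,
      ∑ i ∈ Finset.range n, ∫⁻ y, φ y ∂jumpCountKernel Q c t i (s, x)
        ≤ ENNReal.ofReal (Real.exp (C * max (t - s) 0)) * φ x := by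
    intro n
    induction n with
    | zero => simp
    | succ n ih =>
      intro s hs x
      rw [sum_lintegral_jumpCountKernel_succ _ hφ]
      exact lintegral_stayKernel_add_lintegral_jumpKernel_le hc hc0 hC hφ
        (Finset.measurable_sum _ fun i _ => hφ.lintegral_kernel)
        (fun r hr => hQ r ⟨hs.trans hr.1.le, hr.2⟩ x) fun r hr => ih r (hs.trans hr.1.le)
  rw [minimalKernel, Kernel.sum_apply, lintegral_sum_measure]
  exact ENNReal.tsum_le_of_sum_range_le fun n => hpartial n s hs x

theorem measurable_integral_minimalKernel {f : E → ℝ} (hf : Measurable f) :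
    Measurable fun p => ∫ y, f y ∂minimalKernel Q c t p :=
  (StronglyMeasurable.integral_kernel hf.stronglyMeasurable).measurable

end MinimalKernel

section MinimalKernelEquation

variable {E : Type*} [MeasurableSpace E] {Q : Kernel (ℝ × E) E} [IsMarkovKernel Q] {c : E → ℝ}
  {t B : ℝ} {f : E → ℝ}

theorem minimalKernel_univ_le_one (hc : Measurable c) (hc0 : ∀ x, 0 ≤ c x) (p : ℝ × E) :
    minimalKernel Q c t p univ ≤ 1 := by
  simpa using lintegral_minimalKernel_le (Q := Q) (t := t) hc hc0 le_rfl (φ := fun _ => 1)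
    measurable_const (s₀ := p.1) (by simp) le_rfl p.2

theorem isFiniteKernel_minimalKernel (hc : Measurable c) (hc0 : ∀ x, 0 ≤ c x) :
    IsFiniteKernel (minimalKernel Q c t) :=
  ⟨1, ENNReal.one_lt_top, minimalKernel_univ_le_one hc hc0⟩

theorem abs_integral_minimalKernel_le (hc : Measurable c) (hc0 : ∀ x, 0 ≤ c x)
    (hB : ∀ x, |f x| ≤ B) (p : ℝ × E) : |∫ y, f y ∂minimalKernel Q c t p| ≤ B := by
  have := isFiniteKernel_minimalKernel (Q := Q) (t := t) hc hc0
  refine (norm_integral_le_of_norm_le_const (f := f) (ae_of_all _ hB)).trans ?_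
  exact mul_le_of_le_one_right ((abs_nonneg _).trans (hB p.2)) (ENNReal.toReal_le_of_le_ofReal
    zero_le_one (by simpa using minimalKernel_univ_le_one hc hc0 p))

/-- The source term in the integral equation of the minimal kernel: `c x` times the mean of `f`
at time `t` for the process restarted after a jump from `x` at time `r`. -/
def jumpSource (Q : Kernel (ℝ × E) E) (c : E → ℝ) (t : ℝ) (f : E → ℝ) (x : E) (r : ℝ) : ℝ :=
  c x * ∫ y, ∫ z, f z ∂minimalKernel Q c t (r, y) ∂Q (r, x)

theorem stronglyMeasurable_jumpSource (hf : Measurable f) (x : E) :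
    StronglyMeasurable (jumpSource Q c t f x) := by
  have hjoint : StronglyMeasurable fun p : ℝ × E =>
      ∫ y, ∫ z, f z ∂minimalKernel Q c t (p.1, y) ∂Q p :=
    StronglyMeasurable.integral_kernel_prod_right'
      (f := fun a : (ℝ × E) × E => ∫ z, f z ∂minimalKernel Q c t (a.1.1, a.2))
      ((measurable_integral_minimalKernel hf).comp
        (measurable_fst.fst.prodMk measurable_snd)).stronglyMeasurable
  exact (hjoint.comp_measurable measurable_prodMk_right).const_mul (c x)

theorem intervalIntegrable_jumpSource (hc : Measurable c) (hc0 : ∀ x, 0 ≤ c x)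
    (hf : BoundedMeasurable f) (x : E) (a b : ℝ) :
    IntervalIntegrable (jumpSource Q c t f x) volume a b := by
  obtain ⟨hfm, B, hB⟩ := hf
  refine (intervalIntegrable_const (c := c x * B)).mono_fun'
    (stronglyMeasurable_jumpSource hfm x).aestronglyMeasurable (ae_of_all _ fun r => ?_)
  change ‖c x * _‖ ≤ c x * B
  rw [norm_mul, Real.norm_of_nonneg (hc0 x)]
  refine mul_le_mul_of_nonneg_left ?_ (hc0 x)
  simpa using norm_integral_le_of_norm_le_const (μ := Q (r, x))
    (f := fun y => ∫ z, f z ∂minimalKernel Q c t (r, y)) (C := B)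
    (ae_of_all _ fun y => abs_integral_minimalKernel_le (Q := Q) (t := t) hc hc0 hB (r, y))

/-- Decomposition at the first jump. -/
theorem integral_minimalKernel_eq_duhamel (hc : Measurable c) (hc0 : ∀ x, 0 ≤ c x)
    (hf : BoundedMeasurable f) {s : ℝ} (hs : s ≤ t) (x : E) :
    ∫ y, f y ∂minimalKernel Q c t (s, x) = duhamel (c x) (f x) t (jumpSource Q c t f x) s := by
  have := isFiniteKernel_minimalKernel (Q := Q) (t := t) hc hc0
  have heq : minimalKernel Q c t (s, x) = stayKernel c t (s, x)
      + (minimalKernel Q c t ∘ₖ jumpKernel Q c t) (s, x) := by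
    conv_lhs => rw [minimalKernel_eq_add_comp]
    rfl
  obtain ⟨hstay, hjump⟩ :=
    integrable_add_measure.1 (heq ▸ hf.integrable (minimalKernel Q c t (s, x)))
  rw [heq, integral_add_measure hstay hjump, integral_stayKernel hc hf.1 hs,
    Kernel.integral_comp hjump, integral_jumpKernel hc hc0 hs x hjump.integral_comp]
  rfl

theorem continuousOn_integral_minimalKernel (hc : Measurable c) (hc0 : ∀ x, 0 ≤ c x)
    (hf : BoundedMeasurable f) (x : E) :
    ContinuousOn (fun s => ∫ y, f y ∂minimalKernel Q c t (s, x)) (Iic t) :=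
  (continuous_duhamel (intervalIntegrable_jumpSource hc hc0 hf x)).continuousOn.congr
    fun _ hs => integral_minimalKernel_eq_duhamel hc hc0 hf hs x

theorem hasDerivWithinAt_integral_minimalKernel (hc : Measurable c) (hc0 : ∀ x, 0 ≤ c x)
    (hf : BoundedMeasurable f) {s : ℝ} (hs : s < t) {x : E}
    (hcont : ContinuousWithinAt (jumpSource Q c t f x) (Ici s) s) :
    HasDerivWithinAt (fun s => ∫ y, f y ∂minimalKernel Q c t (s, x))
      (c x * ∫ y, f y ∂minimalKernel Q c t (s, x) - jumpSource Q c t f x s) (Ici s) s := by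
  rw [integral_minimalKernel_eq_duhamel hc hc0 hf hs.le]
  refine (hasDerivWithinAt_duhamel (stronglyMeasurable_jumpSource hf.1 x)
    (intervalIntegrable_jumpSource hc hc0 hf x _ _) hcont).congr_of_eventuallyEq ?_
    (integral_minimalKernel_eq_duhamel hc hc0 hf hs.le x)
  filter_upwards [Ico_mem_nhdsGE hs] with r hr using
    integral_minimalKernel_eq_duhamel hc hc0 hf hr.2.le x

end MinimalKernelEquation

section Uniformization

variable {E : Type*} [MeasurableSpace E] {q : ℝ → Kernel E E} {c W : E → ℝ} {C T : ℝ}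

/-- The jump law at `x` after uniformization: a process with jump rates `μ` from `x` is one which
jumps at rate `c` with this law, which includes jumps from `x` to `x`. -/
def uniformize (c : ℝ) (μ : Measure E) (x : E) : Measure E :=
  (ENNReal.ofReal c)⁻¹ • μ + (1 - (ENNReal.ofReal c)⁻¹ * μ univ) • Measure.dirac x

theorem inv_mul_measure_univ_le_one {c : ℝ} {μ : Measure E} [IsFiniteMeasure μ]
    (hμ : μ.real univ ≤ c) : (ENNReal.ofReal c)⁻¹ * μ univ ≤ 1 := by
  rw [mul_comm, ← div_eq_mul_inv]
  refine ENNReal.div_le_of_le_mul ?_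
  rw [one_mul, ← ofReal_measureReal]
  exact ENNReal.ofReal_le_ofReal hμ

theorem isProbabilityMeasure_uniformize {c : ℝ} {μ : Measure E} [IsFiniteMeasure μ]
    (hμ : μ.real univ ≤ c) (x : E) : IsProbabilityMeasure (uniformize c μ x) :=
  ⟨by simpa [uniformize] using add_tsub_cancel_of_le (inv_mul_measure_univ_le_one hμ)⟩

theorem integrable_uniformize {c : ℝ} (hc : 0 < c) {μ : Measure E} {f : E → ℝ} (hf : Measurable f)
    (hfi : Integrable f μ) (x : E) : Integrable f (uniformize c μ x) :=
  (hfi.smul_measure (by simpa using hc)).add_measure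
    ((integrable_dirac' hf.stronglyMeasurable (by simp [enorm])).smul_measure
      (tsub_le_self.trans_lt ENNReal.one_lt_top).ne)

theorem mul_integral_uniformize {c : ℝ} (hc : 0 < c) {μ : Measure E} [IsFiniteMeasure μ]
    (hμ : μ.real univ ≤ c) {f : E → ℝ} (hf : Measurable f) (hfi : Integrable f μ) (x : E) :
    c * ∫ y, f y ∂uniformize c μ x = ∫ y, (f y - f x) ∂μ + c * f x := by
  obtain ⟨hjump, hstay⟩ := integrable_add_measure.1 (integrable_uniformize hc hf hfi x)
  rw [uniformize, integral_add_measure hjump hstay, integral_smul_measure, integral_smul_measure,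
    integral_dirac' _ _ hf.stronglyMeasurable, integral_sub hfi (integrable_const _),
    ENNReal.toReal_sub_of_le (inv_mul_measure_univ_le_one hμ) ENNReal.one_ne_top,
    ENNReal.toReal_mul, ENNReal.toReal_inv, ENNReal.toReal_ofReal hc.le, ← measureReal_def]
  simp only [smul_eq_mul, ENNReal.toReal_one, integral_const]
  field_simp
  ring

theorem IsTVContinuous.measurable_projIcc (hq : IsTVContinuous q) (hT : 0 ≤ T)
    (hfin : ∀ t ∈ Icc 0 T, ∀ x, IsFiniteMeasure (q t x)) :
    Measurable fun p : ℝ × E => q (projIcc 0 T hT p.1) p.2 := by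
  refine Measure.measurable_of_measurable_coe _ fun A hA => ?_
  have hreal : Measurable (Function.uncurry fun (r : ℝ) (x : E) =>
      (q (projIcc 0 T hT r) x).real A) := by
    refine measurable_uncurry_of_continuous_of_measurable (fun x => ?_) fun r =>
      ((q (projIcc 0 T hT r)).measurable_coe hA).ennreal_toReal
    have hcont : ContinuousOn (fun r => ∫ y, A.indicator 1 y ∂q r x) (Icc 0 T) :=
      hq.continuousOn_integral hfin (u := fun _ => A.indicator 1) (B := 1)
        (fun _ _ => measurable_one.indicator hA)
        (fun _ _ y => by by_cases hy : y ∈ A <;> simp [hy]) (fun _ => continuousOn_const) x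
    simp only [integral_indicator_one hA] at hcont
    exact hcont.comp_continuous (continuous_subtype_val.comp continuous_projIcc)
      fun r => Subtype.prop _
  convert hreal.ennreal_ofReal using 2 with p
  have := hfin _ (projIcc 0 T hT p.1).2 p.2
  simp [Function.uncurry]

/-- On `[0, T]` a process with jump rates `q` is one which jumps from `x` at the rate `c x` with
law `Q (r, x)` at time `r`. -/
def IsJumpLaw (q : ℝ → Kernel E E) (Q : Kernel (ℝ × E) E) (c : E → ℝ) (T : ℝ) : Prop :=
  ∀ r ∈ Icc 0 T, ∀ x, ∀ f : E → ℝ, Measurable f → Integrable f (q r x) →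
    Integrable f (Q (r, x)) ∧ c x * ∫ y, f y ∂Q (r, x) = gen (q r) f x + c x * f x

theorem IsLyapunovOn.exists_isJumpLaw (h : IsLyapunovOn q c W C T) (hT : 0 ≤ T)
    (hq : IsTVContinuous q) :
    ∃ Q : Kernel (ℝ × E) E, IsMarkovKernel Q ∧ IsJumpLaw q Q c T := by
  have hmeas : Measurable fun p : ℝ × E =>
      uniformize (c p.2) (q (projIcc 0 T hT p.1) p.2) p.2 := by
    have hqm := hq.measurable_projIcc hT h.finite
    have hcm : Measurable fun p : ℝ × E => (ENNReal.ofReal (c p.2))⁻¹ :=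
      (h.measurable_c.comp measurable_snd).ennreal_ofReal.inv
    refine Measure.measurable_of_measurable_coe _ fun A hA => ?_
    simp only [uniformize, Measure.add_apply, Measure.smul_apply, smul_eq_mul]
    exact (hcm.mul ((Measure.measurable_coe hA).comp hqm)).add ((measurable_const.sub
      (hcm.mul ((Measure.measurable_coe .univ).comp hqm))).mul
        ((Measure.measurable_coe hA).comp (Measure.measurable_dirac.comp measurable_snd)))
  refine ⟨⟨_, hmeas⟩, ⟨fun p => ?_⟩, fun r hr x f hf hfi => ?_⟩
  · have hp := (projIcc 0 T hT p.1).2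
    have := h.finite _ hp p.2
    exact isProbabilityMeasure_uniformize (h.mass_le _ hp p.2) p.2
  · have := h.finite r hr x
    simp only [Kernel.coe_mk, projIcc_of_mem hT hr]
    exact ⟨integrable_uniformize (h.c_pos x) hf hfi x,
      mul_integral_uniformize (h.c_pos x) (h.mass_le r hr x) hf hfi x⟩

end Uniformization

section TransitionKernel

variable {E : Type*} [MeasurableSpace E] {q : ℝ → Kernel E E} {Q : Kernel (ℝ × E) E}
  [IsMarkovKernel Q] {c W : E → ℝ} {C s t : ℝ} {f : E → ℝ}

theorem IsJumpLaw.jumpSource_eq (hQ : IsJumpLaw q Q c t) (hc : Measurable c) (hc0 : ∀ x, 0 ≤ c x)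
    (hf : BoundedMeasurable f) (hs : s ∈ Icc 0 t) (x : E) [IsFiniteMeasure (q s x)] :
    jumpSource Q c t f x s = gen (q s) (fun y => ∫ z, f z ∂minimalKernel Q c t (s, y)) x
      + c x * ∫ z, f z ∂minimalKernel Q c t (s, x) := by
  have hmeas : Measurable fun y => ∫ z, f z ∂minimalKernel Q c t (s, y) :=
    (measurable_integral_minimalKernel hf.1).comp measurable_prodMk_left
  obtain ⟨B, hB⟩ := hf.2
  have hbdd : ∀ y, |∫ z, f z ∂minimalKernel Q c t (s, y)| ≤ B := fun y =>
    abs_integral_minimalKernel_le hc hc0 hB (s, y)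
  exact (hQ s hs x _ hmeas (BoundedMeasurable.integrable ⟨hmeas, B, hbdd⟩ _)).2

theorem IsLyapunovOn.continuousOn_jumpSource (h : IsLyapunovOn q c W C t)
    (hq : IsTVContinuous q) (hQ : IsJumpLaw q Q c t) (hf : BoundedMeasurable f) (x : E) :
    ContinuousOn (jumpSource Q c t f x) (Icc 0 t) := by
  have hc := h.measurable_c
  have hc0 : ∀ x, 0 ≤ c x := fun x => (h.c_pos x).le
  obtain ⟨B, hB⟩ := hf.2
  have hcont : ∀ y, ContinuousOn (fun s => ∫ z, f z ∂minimalKernel Q c t (s, y)) (Icc 0 t) :=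
    fun y => (continuousOn_integral_minimalKernel hc hc0 hf y).mono Icc_subset_Iic_self
  have hgen := hq.continuousOn_gen h.finite
    (fun s _ => (measurable_integral_minimalKernel hf.1).comp measurable_prodMk_left)
    (fun s _ y => abs_integral_minimalKernel_le hc hc0 hB (s, y)) hcont x
  refine (hgen.add ((hcont x).const_mul (c x))).congr fun s hs => ?_
  have := h.finite s hs x
  exact hQ.jumpSource_eq hc hc0 hf hs x

theorem IsLyapunovOn.isBackwardSolution_minimalKernel (h : IsLyapunovOn q c W C t)
    (hq : IsTVContinuous q) (hQ : IsJumpLaw q Q c t) (hf : BoundedMeasurable f) :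
    IsBackwardSolution q t fun s x => ∫ y, f y ∂minimalKernel Q c t (s, x) := by
  have hc := h.measurable_c
  have hc0 : ∀ x, 0 ≤ c x := fun x => (h.c_pos x).le
  refine ⟨fun s _ => (measurable_integral_minimalKernel hf.1).comp measurable_prodMk_left,
    hf.2.imp fun B hB s _ x => abs_integral_minimalKernel_le hc hc0 hB (s, x),
    fun x => (continuousOn_integral_minimalKernel hc hc0 hf x).mono Icc_subset_Iic_self,
    fun x s hs => ?_⟩
  have hright : ContinuousWithinAt (jumpSource Q c t f x) (Ici s) s :=
    ((h.continuousOn_jumpSource hq hQ hf x s (Ico_subset_Icc_self hs)).mono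
      (Icc_subset_Icc_left hs.1)).mono_of_mem_nhdsWithin (Icc_mem_nhdsGE hs.2)
  refine (hasDerivWithinAt_integral_minimalKernel hc hc0 hf hs.2 hright).congr_deriv ?_
  have := h.finite s (Ico_subset_Icc_self hs) x
  rw [hQ.jumpSource_eq hc hc0 hf (Ico_subset_Icc_self hs) x]
  ring

theorem sectR_minimalKernel_self (hc : Measurable c) (hc0 : ∀ x, 0 ≤ c x) :
    Kernel.sectR (minimalKernel Q c t) t = Kernel.id := by
  have := isFiniteKernel_minimalKernel (Q := Q) (t := t) hc hc0
  refine kernel_ext_of_act fun f hf => ?_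
  rw [act_id hf.1]
  ext x
  simp [act, integral_minimalKernel_eq_duhamel hc hc0 hf le_rfl, duhamel]

theorem IsLyapunovOn.isMarkovKernel_minimalKernel (h : IsLyapunovOn q c W C t)
    (hq : IsTVContinuous q) (hQ : IsJumpLaw q Q c t) (hs : s ∈ Icc 0 t) :
    IsMarkovKernel (Kernel.sectR (minimalKernel Q c t) s) := by
  have hc0 : ∀ x, 0 ≤ c x := fun x => (h.c_pos x).le
  have := isFiniteKernel_minimalKernel (Q := Q) (t := t) h.measurable_c hc0
  have hone := (h.isBackwardSolution_minimalKernel hq hQ (boundedMeasurable_const 1)).unique h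
    (.const 1) (funext fun x => by
      simp [integral_minimalKernel_eq_duhamel h.measurable_c hc0 (boundedMeasurable_const 1) le_rfl,
        duhamel]) hs
  refine ⟨fun x => isProbabilityMeasure_iff_real.2 ?_⟩
  simpa using congrFun hone x

theorem IsLyapunovOn.integrable_minimalKernel (h : IsLyapunovOn q c W C t)
    (hQ : IsJumpLaw q Q c t) (hs : s ∈ Icc 0 t) (x : E) :
    Integrable c (minimalKernel Q c t (s, x)) := by
  have hc0 : ∀ x, 0 ≤ c x := fun x => (h.c_pos x).le
  have hW : ∫⁻ y, ENNReal.ofReal (W y) ∂minimalKernel Q c t (s, x)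
      ≤ ENNReal.ofReal (Real.exp (C * max (t - s) 0)) * ENNReal.ofReal (W x) := by
    refine lintegral_minimalKernel_le h.measurable_c hc0 h.nonneg h.measurable_W.ennreal_ofReal
      (s₀ := 0) (fun r hr x => ?_) hs.1 x
    obtain ⟨hint, heq⟩ := hQ r hr x W h.measurable_W (h.integrable_W r hr x)
    rw [← ofReal_integral_eq_lintegral_ofReal hint (ae_of_all _ fun y => (h.W_pos y).le),
      ← ENNReal.ofReal_mul (hc0 x), heq, ← ENNReal.ofReal_mul (add_nonneg h.nonneg (hc0 x)),
      add_mul]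
    exact ENNReal.ofReal_le_ofReal (add_le_add_left (h.gen_le r hr x) _)
  refine ⟨h.measurable_c.aestronglyMeasurable, ?_⟩
  rw [hasFiniteIntegral_iff_ofReal (ae_of_all _ hc0)]
  exact (lintegral_mono fun y => ENNReal.ofReal_le_ofReal (h.c_le_W y)).trans_lt
    (hW.trans_lt (ENNReal.mul_lt_top ENNReal.ofReal_lt_top ENNReal.ofReal_lt_top))

theorem IsLyapunovOn.exists_isBackwardEvolution (h : IsLyapunovOn q c W C t) (ht : 0 ≤ t)
    (hq : IsTVContinuous q) : ∃ P : ℝ → Kernel E E, IsBackwardEvolution q t P ∧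
      ∀ s ∈ Icc 0 t, ∀ x, Integrable c (P s x) := by
  obtain ⟨Q, hQm, hQ⟩ := h.exists_isJumpLaw ht hq
  refine ⟨fun s => Kernel.sectR (minimalKernel Q c t) s,
    ⟨fun s hs => h.isMarkovKernel_minimalKernel hq hQ hs,
    sectR_minimalKernel_self h.measurable_c fun x => (h.c_pos x).le,
    fun f hf => h.isBackwardSolution_minimalKernel hq hQ hf⟩, fun s hs x => ?_⟩
  simpa using h.integrable_minimalKernel hQ hs x

theorem IsBackwardEvolution.integrable_c (h : IsLyapunovOn q c W C t) (hq : IsTVContinuous q)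
    {P : ℝ → Kernel E E} (hP : IsBackwardEvolution q t P) (hs : s ∈ Icc 0 t) (x : E) :
    Integrable c (P s x) := by
  obtain ⟨R, hR, hint⟩ := h.exists_isBackwardEvolution (hs.1.trans hs.2) hq
  rw [hP.unique h hR hs]
  exact hint s hs x

end TransitionKernel

section InhomogeneousProcess

variable {E : Type*} [MeasurableSpace E] {q : ℝ → Kernel E E} {c W : E → ℝ} {C T s t : ℝ}
  {P : ℝ → ℝ → Kernel E E} {f : E → ℝ}

namespace IsLyapunovOn

theorem tendsto_measure_singleton [MeasurableSingletonClass E] (h : IsLyapunovOn q c W C T)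
    (hP : ∀ τ, 0 ≤ τ → IsBackwardEvolution q τ (P · τ)) {ι : Type*} {l : Filter ι} {σ τ : ι → ℝ}
    (hστ : ∀ᶠ i in l, 0 ≤ σ i ∧ σ i ≤ τ i ∧ τ i ≤ T)
    (hlim : Tendsto (fun i => τ i - σ i) l (𝓝 0)) (x : E) :
    Tendsto (fun i => P (σ i) (τ i) x {x}) l (𝓝 1) := by
  have hlower : Tendsto (fun i => ENNReal.ofReal (1 - 2 * c x * (τ i - σ i))) l (𝓝 1) := by
    simpa using ENNReal.tendsto_ofReal ((hlim.const_mul (2 * c x)).const_sub 1)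
  refine tendsto_of_tendsto_of_tendsto_of_le_of_le' hlower tendsto_const_nhds ?_ ?_
  · filter_upwards [hστ] with i ⟨hσ, hle, hτ⟩
    exact (hP _ (hσ.trans hle)).le_measure_singleton (h.mono hτ) ⟨hσ, hle⟩ x
  · filter_upwards [hστ] with i ⟨hσ, hle, _⟩
    have := (hP _ (hσ.trans hle)).markov _ ⟨hσ, hle⟩
    exact prob_le_one

theorem eventually_abs_gen_act_sub_gen_le (h : IsLyapunovOn q c W C T) (hq : IsTVContinuous q)
    (hP : ∀ τ, 0 ≤ τ → IsBackwardEvolution q τ (P · τ)) (hf : BoundedMeasurable f) (ht : 0 ≤ t)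
    (htT : t < T) (x : E) {δ : ℝ} (hδ : 0 < δ) :
    ∀ᶠ τ in 𝓝[≥] t, ∀ r ∈ Ico t τ, |gen (q r) (act (P r τ) f) x - gen (q t) f x| ≤ δ := by
  obtain ⟨hfm, B, hB⟩ := hf
  set A := ∫ y, 2 * B * (c y + c x) ∂q t x
  have hsmall : ∀ᶠ τ in 𝓝[≥] t, (τ - t) * |A| < δ / 2 := by
    have hlim : Tendsto (fun τ => (τ - t) * |A|) (𝓝[≥] t) (𝓝 0) :=
      tendsto_nhdsWithin_of_tendsto_nhds (Continuous.tendsto' (by fun_prop) _ _ (by simp))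
    exact hlim.eventually_lt_const (half_pos hδ)
  obtain ⟨u, htu, hu⟩ := mem_nhdsGE_iff_exists_Ico_subset.1 <| nhdsWithin_mono t
    (Ici_subset_Ici.2 ht) (hq.eventually_abs_integral_sub_le ht x (B + B) (half_pos hδ))
  filter_upwards [hsmall, Ico_mem_nhdsGE htu, Ico_mem_nhdsGE htT] with τ hτA hτu hτT r hr
  have hr0 : r ∈ Icc 0 τ := ⟨ht.trans hr.1, hr.2.le⟩
  have ht0 : t ∈ Icc 0 τ := ⟨ht, hτu.1⟩
  have hPτ := hP τ (ht.trans hτu.1)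
  have := hPτ.markov r hr0
  have hw : ∀ y, |act (P r τ) f y| ≤ B := abs_act_le hB
  have hchange : |gen (q r) (act (P r τ) f) x - gen (q t) (act (P r τ) f) x| ≤ δ / 2 :=
    hu ⟨hr.1, hr.2.trans hτu.2⟩ _ ((measurable_act hfm).sub_const _)
      fun y => (abs_sub _ _).trans (add_le_add (hw y) (hw x))
  have hfrozen : |gen (q t) (act (P r τ) f) x - gen (q t) f x| ≤ (τ - t) * |A| :=
    calc _ ≤ (τ - r) * A := hPτ.abs_gen_act_sub_gen_le (h.mono hτT.2.le) hfm hB ht0 hr0 x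
      _ ≤ (τ - r) * |A| := mul_le_mul_of_nonneg_left (le_abs_self A) (sub_nonneg.2 hr.2.le)
      _ ≤ (τ - t) * |A| := by gcongr; exact hr.1
  linarith [abs_sub_le (gen (q r) (act (P r τ) f) x) (gen (q t) (act (P r τ) f) x)
    (gen (q t) f x)]

theorem hasDerivWithinAt_act_terminal (h : IsLyapunovOn q c W C T) (hq : IsTVContinuous q)
    (hP : ∀ τ, 0 ≤ τ → IsBackwardEvolution q τ (P · τ)) (hf : BoundedMeasurable f) (ht : 0 ≤ t)
    (htT : t < T) (x : E) :
    HasDerivWithinAt (fun τ => act (P t τ) f x) (gen (q t) f x) (Ici t) t := by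
  refine hasDerivWithinAt_iff_isLittleO.2 (Asymptotics.isLittleO_iff.2 fun δ hδ => ?_)
  filter_upwards [self_mem_nhdsWithin,
    h.eventually_abs_gen_act_sub_gen_le hq hP hf ht htT x hδ] with τ (hτ : t ≤ τ) hgen
  have hτ0 : 0 ≤ τ := ht.trans hτ
  have hterminal : ∀ r, 0 ≤ r → act (P r r) f = f := fun r hr => by
    rw [(hP r hr).terminal, act_id hf.1]
  have hsol := (hP τ hτ0).isBackwardSolution f hf
  have hτt : |τ - t| = τ - t := abs_of_nonneg (sub_nonneg.2 hτ)
  simpa [hterminal t ht, hterminal τ hτ0, hτt] using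
    hsol.abs_sub_sub_mul_le ⟨ht, hτ⟩ hgen

theorem tendsto_forward (h : IsLyapunovOn q c W C T) (hq : IsTVContinuous q)
    (hP : ∀ τ, 0 ≤ τ → IsBackwardEvolution q τ (P · τ)) (hf : BoundedMeasurable f)
    (hs : s ∈ Icc 0 t) (htT : t < T) (x : E) :
    Tendsto (fun ε => (act (P s (t + ε)) f x - act (P s t) f x) / ε) (𝓝[>] 0)
      (𝓝 (act (P s t) (gen (q t) f) x)) := by
  obtain ⟨B, hB⟩ := hf.2
  have ht : 0 ≤ t := hs.1.trans hs.2
  have hm := (hP t ht).markov s hs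
  have hlim : Tendsto (fun ε => ∫ y, (act (P t (t + ε)) f y - f y) / ε ∂P s t x) (𝓝[>] 0)
      (𝓝 (act (P s t) (gen (q t) f) x)) := by
    refine tendsto_integral_filter_of_dominated_convergence (fun y => 2 * B * c y)
      (Eventually.of_forall fun ε =>
        (((measurable_act hf.1).sub hf.1).div_const ε).aestronglyMeasurable) ?_
      (((hP t ht).integrable_c (h.mono htT.le) hq hs x).const_mul _) (ae_of_all _ fun y => ?_)
    · filter_upwards [Ioc_mem_nhdsGT (sub_pos.2 htT)] with ε ⟨hε, hεT⟩
      refine ae_of_all _ fun y => ?_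
      rw [Real.norm_eq_abs, abs_div, abs_of_pos hε, div_le_iff₀ hε]
      simpa using (hP (t + ε) (by linarith)).abs_act_sub_le (h.mono (by linarith)) hf.1 hB
        ⟨ht, by linarith⟩ y
    · simpa [(hP t ht).terminal, act_id hf.1] using hasDerivWithinAt_Ici_iff_tendsto_slope_zero.1
        (h.hasDerivWithinAt_act_terminal hq hP hf ht htT y)
  refine hlim.congr' ?_
  filter_upwards [self_mem_nhdsWithin] with ε (hε : 0 < ε)
  have hPε := hP (t + ε) (by linarith)
  have hmε := hPε.markov t ⟨ht, by linarith⟩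
  rw [integral_div, hPε.eq_comp (h.mono htT.le) (hP t ht) hs (by linarith), act_comp hf,
    integral_sub (hf.act.integrable _) (hf.integrable _)]
  rfl

end IsLyapunovOn

theorem HasLocalLyapunov.isGeneratedBy [MeasurableSingletonClass E] (hL : HasLocalLyapunov q)
    (hq : IsTVContinuous q) (hP : ∀ t, 0 ≤ t → IsBackwardEvolution q t (P · t)) :
    IsGeneratedBy q P where
  markov s t hs hst := (hP t (hs.trans hst)).markov s ⟨hs, hst⟩
  refl s hs := (hP s hs).terminal
  jump_right s hs x := by
    obtain ⟨c, W, C, h⟩ := hL (s + 1) (by linarith)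
    refine h.tendsto_measure_singleton hP (σ := fun _ => s) (τ := id) ?_
      (tendsto_nhdsWithin_of_tendsto_nhds (Continuous.tendsto' (by fun_prop) _ _ (by simp))) x
    filter_upwards [Ioc_mem_nhdsGT (lt_add_one s)] with t ht using ⟨hs, ht.1.le, ht.2⟩
  jump_left t ht x := by
    obtain ⟨c, W, C, h⟩ := hL t ht.le
    refine h.tendsto_measure_singleton hP (σ := id) (τ := fun _ => t) ?_
      (tendsto_nhdsWithin_of_tendsto_nhds (Continuous.tendsto' (by fun_prop) _ _ (by simp))) x
    filter_upwards [Ico_mem_nhdsLT ht] with s hs using ⟨hs.1, hs.2.le, le_rfl⟩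
  semigroup s r t hs hsr hrt := by
    have hr : 0 ≤ r := hs.trans hsr
    obtain ⟨c, W, C, h⟩ := hL r hr
    have hcomp := (hP t (hr.trans hrt)).eq_comp h (hP r hr) ⟨hs, hsr⟩ hrt
    exact hcomp
  backward f hf s t hs hst x := hasDerivWithinAt_Ici_iff_tendsto_slope_zero.1
    (((hP t (hs.trans hst.le)).isBackwardSolution f hf).hasDeriv x s ⟨hs, hst⟩)
  forward f hf s t hs hst x := by
    have ht : 0 ≤ t := hs.trans hst.le
    obtain ⟨c, W, C, h⟩ := hL (t + 1) (by linarith)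
    have hle : t ≤ t + 1 := by linarith
    exact ⟨h.integrable_gen ⟨ht, hle⟩ hf ((hP t ht).integrable_c (h.mono hle) hq ⟨hs, hst.le⟩ x),
      h.tendsto_forward hq hP hf ⟨hs, hst.le⟩ (lt_add_one t) x⟩

theorem IsGeneratedBy.continuousWithinAt_act_Iic [MeasurableSingletonClass E]
    (h : IsGeneratedBy q P) (hf : BoundedMeasurable f) (hs : 0 < s) (hst : s ≤ t) (x : E) :
    ContinuousWithinAt (fun r => act (P r t) f x) (Iic s) s := by
  have := h.markov s t hs.le hst
  obtain ⟨hgm, B, hB⟩ := hf.act (P := P s t)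
  have hjump : Tendsto (fun r => 2 * B * (1 - (P r s x).real {x})) (𝓝[<] s) (𝓝 0) := by
    have hreal := (ENNReal.tendsto_toReal ENNReal.one_ne_top).comp (h.jump_left s hs x)
    simpa [measureReal_def] using (hreal.const_sub 1).const_mul (2 * B)
  refine continuousWithinAt_Iio_iff_Iic.1 (tendsto_iff_norm_sub_tendsto_zero.2
    (squeeze_zero' (Eventually.of_forall fun _ => norm_nonneg _) ?_ hjump))
  filter_upwards [Ioo_mem_nhdsLT hs] with r hr
  have := h.markov r s hr.1.le hr.2.le
  rw [h.semigroup r s t hr.1.le hr.2.le hst, act_comp hf]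
  exact abs_act_sub_le hgm hB x

theorem IsGeneratedBy.isBackwardEvolution [MeasurableSingletonClass E] (h : IsGeneratedBy q P)
    (ht : 0 ≤ t) : IsBackwardEvolution q t (P · t) := by
  refine ⟨fun s hs => h.markov s t hs.1 hs.2, h.refl t ht, fun f hf => ?_⟩
  have hderiv : ∀ x, ∀ s ∈ Ico 0 t, HasDerivWithinAt (fun r => act (P r t) f x)
      (-gen (q s) (act (P s t) f) x) (Ici s) s := fun x s hs =>
    hasDerivWithinAt_Ici_iff_tendsto_slope_zero.2 (h.backward f hf s t hs.1 hs.2 x)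
  refine ⟨fun s _ => measurable_act hf.1, hf.2.imp fun B hB s hs => ?_, fun x s hs => ?_, hderiv⟩
  · have := h.markov s t hs.1 hs.2
    exact abs_act_le hB
  · rw [← Icc_union_Icc_eq_Icc hs.1 hs.2, continuousWithinAt_union]
    constructor
    · rcases hs.1.eq_or_lt with rfl | hs0
      · simp
      · exact (h.continuousWithinAt_act_Iic hf hs0 hs.2 x).mono Icc_subset_Iic_self
    · rcases hs.2.eq_or_lt with rfl | hst
      · simp
      · exact (hderiv x s ⟨hs.1, hst⟩).continuousWithinAt.mono Icc_subset_Ici_self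

end InhomogeneousProcess

end JumpProcess

end

theorem theorem5p1_general {E : Type*} [MeasurableSpace E] [MeasurableSingletonClass E]
    {q : ℝ → Kernel E E} (hL : JumpProcess.HasLocalLyapunov q)
    (hq : JumpProcess.IsTVContinuous q) :
    ∃ P : ℝ → ℝ → Kernel E E, JumpProcess.IsGeneratedBy q P ∧
      ∀ P' : ℝ → ℝ → Kernel E E, JumpProcess.IsGeneratedBy q P' →
        ∀ s t : ℝ, 0 ≤ s → s ≤ t → P' s t = P s t := by
  have hexists : ∀ t, 0 ≤ t → ∃ R : ℝ → Kernel E E, JumpProcess.IsBackwardEvolution q t R :=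
    fun t ht =>
      let ⟨_, _, _, h⟩ := hL t ht
      (h.exists_isBackwardEvolution ht hq).imp fun _ hR => hR.1
  choose! R hR using hexists
  refine ⟨fun s t => R t s, hL.isGeneratedBy hq hR, fun P' hP' s t hs hst => ?_⟩
  obtain ⟨c, W, C, h⟩ := hL t (hs.trans hst)
  exact (hP'.isBackwardEvolution (hs.trans hst)).unique h (hR t (hs.trans hst)) ⟨hs, hst⟩

theorem theorem5p1 {E : Type*} [TopologicalSpace E] [PolishSpace E] [LocallyCompactSpace E]
    [MeasurableSpace E] [BorelSpace E] (q : ℝ → Kernel E E)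
    (hq : JumpProcess.IsStableConservative q)
    (hA1 : JumpProcess.FrozenWellPosed q)
    (hA2 : JumpProcess.TimeContinuous q)
    (hA3 : JumpProcess.LyapunovCondition q) :
    ∃ P : ℝ → ℝ → Kernel E E, JumpProcess.IsGeneratedBy q P ∧
      ∀ P' : ℝ → ℝ → Kernel E E, JumpProcess.IsGeneratedBy q P' →
        ∀ s t : ℝ, 0 ≤ s → s ≤ t → P' s t = P s t :=
  theorem5p1_general (hq.hasLocalLyapunov hA3) hA2.isTVContinuous
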